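/- Let $n\ge 1$ be an integer, $\theta\in(0,\frac{\pi}{2})$, $p>1$ and $q\le n+1$ (with $p,q$ real). Let $E_{n+1}$ be the last vector of the standard basis of $\mathbb{R}^{n+1}$, $e=-E_{n+1}$, and let $$\mathcal{C}^n_\theta=\{\zeta\in\mathbb{R}^{n+1}:\ \zeta_{n+1}\ge 0,\ |\zeta-\cos\theta\, e|=1\}$$ be the capillary spherical cap with its induced Riemannian metric, gradient $\nabla$ and Hessian $\nabla^2$; its boundary is $\partial\mathcal{C}^n_\theta=\{\zeta\in\mathcal{C}^n_\theta:\zeta_{n+1}=0\}$, and $\mu$ is the unit outward co-normal of $\partial\mathcal{C}^n_\theta$ in $\mathcal{C}^n_\theta$. Let $f$ be a positive function on $\mathcal{C}^n_\theta$, smooth up to the boundary. For every real $\gamma$ with $$0<\gamma<\min\Big\{\frac{2(p-1)}{n},\,2\Big\}$$ there exists a constant $C^*>0$, depending only on $\gamma,n,p,q,\theta$ and $f$, such that every positive function $h$ on $\mathcal{C}^n_\theta$, smooth up to the boundary and strictly convex (that is, $\nabla^2h+hI$ is positive definite on $\mathcal{C}^n_\theta$), which solves the capillary $L_p$ dual Minkowski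 equation $$\begin{cases}\det(\nabla^2h+hI)=f\,h^{p-1}\,(h^2+|\nabla h|^2)^{\frac{n+1-q}{2}} & \text{in } \mathcal{C}^n_\theta,\\ \nabla_\mu h=\cot\theta\, h & \text{on }\partial\mathcal{C}^n_\theta,\end{cases}$$ satisfies $$\frac{|\nabla h|^2}{h^\gamma}\le C^*\Big(\max_{\mathcal{C}^n_\theta}h\Big)^{2-\gamma}\qquad\text{on }\mathcal{C}^n_\theta.$$ -/

import Mathlib

open scoped ContDiff InnerProductSpace

noncomputable section

namespace Capillary

/-- The ambient Euclidean space `ℝ^{n+1}`. -/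
abbrev Amb (n : ℕ) : Type := EuclideanSpace ℝ (Fin (n + 1))

/-- The last vector `E_{n+1}` of the standard basis. -/
def eLast (n : ℕ) : Amb n := EuclideanSpace.single (Fin.last n) (1 : ℝ)

/-- `e = -E_{n+1}`, the outward unit normal of the half-space `{x_{n+1} ≥ 0}`. -/
def eDown (n : ℕ) : Amb n := -eLast n

/-- The capillary spherical cap `C_θ^n` (unit radius, contact angle `θ`, boundary included): the
points of the closed upper half-space at distance `1` from `cos θ • e`. -/
def cap (n : ℕ) (θ : ℝ) : Set (Amb n) :=
  {ζ | 0 ≤ ζ (Fin.last n) ∧ ‖ζ - Real.cos θ • eDown n‖ = 1}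

/-- The boundary `∂C_θ^n`, the part of the cap in the hyperplane `{x_{n+1} = 0}`. -/
def capBoundary (n : ℕ) (θ : ℝ) : Set (Amb n) :=
  {ζ | ζ ∈ cap n θ ∧ ζ (Fin.last n) = 0}

/-- The outward unit normal `x - cos θ • e` of the cap at `x` (as a vector field on the
ambient space; it has norm `1` on the cap). -/
def nu {n : ℕ} (θ : ℝ) (x : Amb n) : Amb n := x - Real.cos θ • eDown n

/-- The tangent space of the cap at `x`, with the induced inner product. -/
abbrev tangent {n : ℕ} (θ : ℝ) (x : Amb n) : Submodule ℝ (Amb n) := (Submodule.span ℝ {nu θ x})ᗮ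

/-- The outward unit co-normal `μ = sin θ • e + cos θ • ν̄` of `∂C_θ^n` in `C_θ^n`, where
`ν̄ = ξ / sin θ` is the outward unit normal of `∂C_θ^n` in the hyperplane `{x_{n+1} = 0}`. -/
def conormal {n : ℕ} (θ : ℝ) (ξ : Amb n) : Amb n :=
  Real.sin θ • eDown n + Real.cos θ • ((Real.sin θ)⁻¹ • ξ)

/-- Smoothness (up to the boundary) of a function on the cap: it is the restriction of a
`C^∞` function on the ambient space. -/
def CapSmooth {n : ℕ} {θ : ℝ} (h : cap n θ → ℝ) : Prop :=
  ∃ H : Amb n → ℝ, ContDiff ℝ ∞ H ∧ ∀ ξ : cap n θ, H ξ = h ξ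

open Classical in
/-- A smooth ambient extension of a smooth function on the cap. The gradient and the Hessian
below do not depend on which one is taken: see `capGrad_eq` and `capHess_eq`. -/
def capExt {n : ℕ} {θ : ℝ} (h : cap n θ → ℝ) : Amb n → ℝ :=
  if hs : CapSmooth h then hs.choose else 0

/-- The ambient gradient minus its component along the normal. At the points of the cap this is
the Riemannian gradient of the restriction of `H`. -/
def tanGrad {n : ℕ} (θ : ℝ) (H : Amb n → ℝ) (x : Amb n) : Amb n :=
  gradient H x - ⟪nu θ x, gradient H x⟫_ℝ • nu θ x

/-- The covariant derivative `v ↦ ∇_v (grad H)` on the cap at `x`: the Levi-Civita connection of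
the induced metric is the tangential part of the ambient derivative. -/
def tanHess {n : ℕ} (θ : ℝ) (H : Amb n → ℝ) (x : Amb n) : tangent θ x →ₗ[ℝ] tangent θ x :=
  ((tangent θ x).orthogonalProjectionOnto.comp
    ((fderiv ℝ (tanGrad θ H) x).comp (tangent θ x).subtypeL)).toLinearMap

/-- The Riemannian gradient `∇h` of a smooth function on the cap. -/
def capGrad {n : ℕ} {θ : ℝ} (h : cap n θ → ℝ) (ξ : cap n θ) : Amb n :=
  tanGrad θ (capExt h) ξ

/-- The Riemannian Hessian `∇²h` of a smooth function on the cap, as the endomorphism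
`v ↦ ∇_v ∇h` of the tangent space. -/
def capHess {n : ℕ} {θ : ℝ} (h : cap n θ → ℝ) (ξ : cap n θ) :
    tangent θ (ξ : Amb n) →ₗ[ℝ] tangent θ (ξ : Amb n) :=
  tanHess θ (capExt h) ξ

/-- The endomorphism `∇²h + h I` of the tangent space at `ξ`. -/
def capB {n : ℕ} {θ : ℝ} (h : cap n θ → ℝ) (ξ : cap n θ) :
    tangent θ (ξ : Amb n) →ₗ[ℝ] tangent θ (ξ : Amb n) :=
  capHess h ξ + h ξ • LinearMap.id

/-- `h` is a positive, smooth, strictly convex solution of the capillary `L_p` dual Minkowski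
equation with data `f`. -/
structure IsSolution {n : ℕ} {θ : ℝ} (p q : ℝ) (f h : cap n θ → ℝ) : Prop where
  smooth : CapSmooth h
  pos : ∀ ξ, 0 < h ξ
  strictConvex : ∀ (ξ : cap n θ) (v : tangent θ (ξ : Amb n)), v ≠ 0 → 0 < ⟪capB h ξ v, v⟫_ℝ
  equation : ∀ ξ : cap n θ,
    LinearMap.det (capB h ξ) =
      f ξ * h ξ ^ (p - 1) * (h ξ ^ 2 + ‖capGrad h ξ‖ ^ 2) ^ (((n : ℝ) + 1 - q) / 2)
  boundary : ∀ ξ : cap n θ, (ξ : Amb n) ∈ capBoundary n θ →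
    ⟪capGrad h ξ, conormal θ (ξ : Amb n)⟫_ℝ = Real.cot θ * h ξ

/-! The gradient and the Hessian can be computed from any smooth extension. -/

theorem inner_eLast {n : ℕ} (x : Amb n) : ⟪eLast n, x⟫_ℝ = x (Fin.last n) := by
  simp [eLast, EuclideanSpace.inner_single_left]

theorem norm_nu {n : ℕ} {θ : ℝ} {ξ : Amb n} (hξ : ξ ∈ cap n θ) : ‖nu θ ξ‖ = 1 := hξ.2

theorem mem_tangent {n : ℕ} {θ : ℝ} {x v : Amb n} : v ∈ tangent θ x ↔ ⟪nu θ x, v⟫_ℝ = 0 :=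
  Submodule.mem_orthogonal_singleton_iff_inner_right

theorem tanGrad_mem {n : ℕ} {θ : ℝ} {ξ : Amb n} (hξ : ξ ∈ cap n θ) (H : Amb n → ℝ) :
    tanGrad θ H ξ ∈ tangent θ ξ := by
  rw [mem_tangent, tanGrad, inner_sub_right, inner_smul_right, real_inner_self_eq_norm_sq,
    norm_nu hξ]
  ring

theorem capExt_spec {n : ℕ} {θ : ℝ} {h : cap n θ → ℝ} (hs : CapSmooth h) :
    ContDiff ℝ ∞ (capExt h) ∧ ∀ ξ : cap n θ, capExt h ξ = h ξ := by
  have : capExt h = hs.choose := by simp [capExt, hs]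
  rw [this]
  exact hs.choose_spec

/-- Differentiation along a geodesic that starts in an interior point or upwards, and so stays in
the cap for a short time. -/
theorem fderiv_eq_zero_aux {n : ℕ} {θ : ℝ} {F : Type*} [NormedAddCommGroup F] [NormedSpace ℝ F]
    {G : Amb n → F} {ξ : Amb n} (hG : DifferentiableAt ℝ G ξ) (h0 : ∀ x ∈ cap n θ, G x = 0)
    (hξ : ξ ∈ cap n θ) {v : Amb n} (hv : v ∈ tangent θ ξ)
    (hpos : 0 < ξ (Fin.last n) ∨ 0 < v (Fin.last n)) : fderiv ℝ G ξ v = 0 := by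
  by_cases hv0 : v = 0
  · rw [hv0, map_zero]
  have hn : 0 < ‖v‖ := norm_pos_iff.2 hv0
  set w : Amb n := ‖v‖⁻¹ • v with hw
  have hw1 : ‖w‖ = 1 := by
    rw [hw, norm_smul, norm_inv, norm_norm, inv_mul_cancel₀ hn.ne']
  have hwν : ⟪nu θ ξ, w⟫_ℝ = 0 := by
    rw [hw, inner_smul_right, mem_tangent.1 hv, mul_zero]
  let c : ℝ → Amb n := fun t =>
    Real.cos θ • eDown n + (Real.cos t • nu θ ξ + Real.sin t • w)
  have hc0 : c 0 = ξ := by simp [c, nu]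
  have hc : HasDerivAt c w 0 := by
    have h1 : HasDerivAt (fun t : ℝ => Real.cos t • nu θ ξ) (-Real.sin 0 • nu θ ξ) 0 :=
      (Real.hasDerivAt_cos 0).smul_const _
    have h2 : HasDerivAt (fun t : ℝ => Real.sin t • w) (Real.cos 0 • w) 0 :=
      (Real.hasDerivAt_sin 0).smul_const _
    have h3 := (h1.add h2).const_add (Real.cos θ • eDown n)
    simp only [Real.sin_zero, Real.cos_zero, neg_zero, zero_smul, one_smul, zero_add] at h3
    exact h3
  have hht : HasDerivAt (fun t => (c t) (Fin.last n)) (w (Fin.last n)) 0 := by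
    have := (innerSL ℝ (eLast n)).hasFDerivAt.comp_hasDerivAt (0 : ℝ) hc
    simpa [Function.comp_def, inner_eLast] using this
  have hnorm : ∀ t, ‖c t - Real.cos θ • eDown n‖ = 1 := by
    intro t
    have h1 : c t - Real.cos θ • eDown n = Real.cos t • nu θ ξ + Real.sin t • w := by
      simp [c]
    have h2 : ‖c t - Real.cos θ • eDown n‖ ^ 2 = 1 := by
      rw [h1, norm_add_sq_real, norm_smul, norm_smul, inner_smul_left, inner_smul_right, hwν,
        norm_nu hξ, hw1]
      simp
    nlinarith [norm_nonneg (c t - Real.cos θ • eDown n)]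
  have hev : ∀ᶠ t in nhdsWithin (0 : ℝ) (Set.Ioi 0), c t ∈ cap n θ := by
    rcases hpos with hpos | hpos
    · have h1 : ∀ᶠ t in nhds (0 : ℝ), 0 < (c t) (Fin.last n) :=
        hht.continuousAt.eventually (lt_mem_nhds (by simp only [hc0]; exact hpos))
      filter_upwards [nhdsWithin_le_nhds h1] with t ht
      exact ⟨ht.le, hnorm t⟩
    have hwpos : 0 < w (Fin.last n) := by
      rw [hw, PiLp.smul_apply, smul_eq_mul]
      positivity
    have h1 := hht.hasDerivWithinAt (s := Set.Ioi 0)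
    rw [hasDerivWithinAt_iff_tendsto_slope' (by simp)] at h1
    have h2 := h1.eventually (lt_mem_nhds hwpos)
    filter_upwards [h2, self_mem_nhdsWithin] with t ht ht0
    have ht0' : (0 : ℝ) < t := ht0
    refine ⟨?_, hnorm t⟩
    rw [slope_def_field, hc0, sub_zero, div_pos_iff_of_pos_right ht0'] at ht
    linarith [hξ.1]
  have hGc : HasDerivWithinAt (fun t => G (c t)) (fderiv ℝ G ξ w) (Set.Ioi 0) 0 := by
    have h1 : HasFDerivAt G (fderiv ℝ G ξ) (c 0) := by
      rw [hc0]
      exact hG.hasFDerivAt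
    exact (h1.comp_hasDerivAt (0 : ℝ) hc).hasDerivWithinAt
  have hz : HasDerivWithinAt (fun t => G (c t)) (0 : F) (Set.Ioi 0) 0 := by
    refine (hasDerivWithinAt_const (0 : ℝ) (Set.Ioi 0) (0 : F)).congr_of_eventuallyEq ?_ ?_
    · filter_upwards [hev] with t ht
      exact h0 _ ht
    · simp only [hc0]
      exact h0 _ hξ
  have hw0 : fderiv ℝ G ξ w = 0 :=
    (uniqueDiffWithinAt_Ioi (0 : ℝ)).eq_deriv _ hGc hz
  rw [hw, map_smul] at hw0
  exact (smul_eq_zero.1 hw0).resolve_left (inv_ne_zero hn.ne')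

/-- The tangential derivatives of a function that vanishes on the cap vanish on the cap. -/
theorem fderiv_eq_zero {n : ℕ} {θ : ℝ} (hθ : Real.sin θ ≠ 0) {F : Type*} [NormedAddCommGroup F]
    [NormedSpace ℝ F] {G : Amb n → F} {ξ : Amb n} (hG : DifferentiableAt ℝ G ξ)
    (h0 : ∀ x ∈ cap n θ, G x = 0) (hξ : ξ ∈ cap n θ) {v : Amb n} (hv : v ∈ tangent θ ξ) :
    fderiv ℝ G ξ v = 0 := by
  rcases hξ.1.lt_or_eq with hpos | hzero
  · exact fderiv_eq_zero_aux hG h0 hξ hv (Or.inl hpos)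
  have hνl : (nu θ ξ) (Fin.last n) = Real.cos θ := by
    simp [nu, eDown, eLast, ← hzero]
  set w : Amb n := eLast n - Real.cos θ • nu θ ξ with hw
  have hwT : w ∈ tangent θ ξ := by
    rw [mem_tangent, hw, inner_sub_right, inner_smul_right, real_inner_self_eq_norm_sq,
      norm_nu hξ, real_inner_comm, inner_eLast, hνl]
    ring
  have hwl : w (Fin.last n) = Real.sin θ ^ 2 := by
    have h1 : (eLast n) (Fin.last n) = 1 := by simp [eLast]
    rw [hw, PiLp.sub_apply, PiLp.smul_apply, hνl, h1, Real.sin_sq, smul_eq_mul]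
    ring
  have hs : 0 < Real.sin θ ^ 2 := by positivity
  have h1 := fderiv_eq_zero_aux hG h0 hξ hwT (Or.inr (by rw [hwl]; exact hs))
  set k : ℝ := (1 + |v (Fin.last n)|) / Real.sin θ ^ 2 with hk
  have h2 := fderiv_eq_zero_aux hG h0 hξ (v := v + k • w)
    (Submodule.add_mem _ hv (Submodule.smul_mem _ _ hwT)) (Or.inr (by
      rw [PiLp.add_apply, PiLp.smul_apply, hwl, smul_eq_mul, hk, div_mul_cancel₀ _ hs.ne']
      linarith [neg_abs_le (v (Fin.last n))]))
  rwa [map_add, map_smul, h1, smul_zero, add_zero] at h2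

theorem tanGrad_congr {n : ℕ} {θ : ℝ} (hθ : Real.sin θ ≠ 0) {H K : Amb n → ℝ}
    (hH : ContDiff ℝ ∞ H) (hK : ContDiff ℝ ∞ K) (hHK : ∀ x ∈ cap n θ, H x = K x) {ξ : Amb n}
    (hξ : ξ ∈ cap n θ) : tanGrad θ H ξ = tanGrad θ K ξ := by
  have hdH : DifferentiableAt ℝ H ξ := hH.differentiable (by simp) ξ
  have hdK : DifferentiableAt ℝ K ξ := hK.differentiable (by simp) ξ
  have hmem : tanGrad θ H ξ - tanGrad θ K ξ ∈ tangent θ ξ :=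
    Submodule.sub_mem _ (tanGrad_mem hξ H) (tanGrad_mem hξ K)
  have key : ∀ v ∈ tangent θ ξ, ⟪tanGrad θ H ξ - tanGrad θ K ξ, v⟫_ℝ = 0 := by
    intro v hv
    have h1 := fderiv_eq_zero hθ (hdH.sub hdK) (fun x hx => sub_eq_zero.2 (hHK x hx)) hξ hv
    rw [fderiv_sub hdH hdK, sub_apply] at h1
    have h2 : ∀ L : Amb n → ℝ, ⟪tanGrad θ L ξ, v⟫_ℝ = fderiv ℝ L ξ v := by
      intro L
      rw [tanGrad, inner_sub_left, real_inner_smul_left, mem_tangent.1 hv, mul_zero, sub_zero,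
        gradient, InnerProductSpace.toDual_symm_apply]
    rw [inner_sub_left, h2, h2, h1]
  exact sub_eq_zero.1 (inner_self_eq_zero.1 (key _ hmem))

theorem differentiable_tanGrad {n : ℕ} {θ : ℝ} {H : Amb n → ℝ} (hH : ContDiff ℝ ∞ H) :
    Differentiable ℝ (tanGrad θ H) := by
  have h1 : Differentiable ℝ (gradient H) :=
    (InnerProductSpace.toDual ℝ (Amb n)).symm.differentiable.comp
      ((hH.fderiv_right (m := ∞) (by simp)).differentiable (by simp))
  have h2 : Differentiable ℝ (nu (n := n) θ) := differentiable_id.sub_const _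
  exact h1.sub ((h2.inner ℝ h1).smul h2)

theorem tanHess_congr {n : ℕ} {θ : ℝ} (hθ : Real.sin θ ≠ 0) {H K : Amb n → ℝ}
    (hH : ContDiff ℝ ∞ H) (hK : ContDiff ℝ ∞ K) (hHK : ∀ x ∈ cap n θ, H x = K x) {ξ : Amb n}
    (hξ : ξ ∈ cap n θ) : tanHess θ H ξ = tanHess θ K ξ := by
  have hdH := differentiable_tanGrad (θ := θ) hH ξ
  have hdK := differentiable_tanGrad (θ := θ) hK ξ
  ext1 v
  have h1 := fderiv_eq_zero hθ (hdH.sub hdK)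
    (fun x hx => sub_eq_zero.2 (tanGrad_congr hθ hH hK hHK hx)) hξ v.2
  rw [fderiv_sub hdH hdK, sub_apply, sub_eq_zero] at h1
  exact congrArg (tangent θ ξ).orthogonalProjectionOnto h1

/-- The gradient of `h` on the cap is computed from any smooth extension. -/
theorem capGrad_eq {n : ℕ} {θ : ℝ} (hθ : Real.sin θ ≠ 0) {h : cap n θ → ℝ} {H : Amb n → ℝ}
    (hH : ContDiff ℝ ∞ H) (hHh : ∀ ξ : cap n θ, H ξ = h ξ) (ξ : cap n θ) :
    capGrad h ξ = tanGrad θ H ξ := by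
  have hs := capExt_spec ⟨H, hH, hHh⟩
  exact tanGrad_congr hθ hs.1 hH (fun x hx => (hs.2 ⟨x, hx⟩).trans (hHh ⟨x, hx⟩).symm) ξ.2

/-- The Hessian of `h` on the cap is computed from any smooth extension. -/
theorem capHess_eq {n : ℕ} {θ : ℝ} (hθ : Real.sin θ ≠ 0) {h : cap n θ → ℝ} {H : Amb n → ℝ}
    (hH : ContDiff ℝ ∞ H) (hHh : ∀ ξ : cap n θ, H ξ = h ξ) (ξ : cap n θ) :
    capHess h ξ = tanHess θ H ξ := by
  have hs := capExt_spec ⟨H, hH, hHh⟩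
  exact tanHess_congr hθ hs.1 hH (fun x hx => (hs.2 ⟨x, hx⟩).trans (hHh ⟨x, hx⟩).symm) ξ.2

/-- `conormal θ ξ` is a unit tangent vector of the cap, orthogonal to the tangent vectors of the
boundary, and points out of the half-space. -/
theorem conormal_spec {n : ℕ} {θ : ℝ} (hθ : 0 < Real.sin θ) {ξ : Amb n}
    (hξ : ξ ∈ capBoundary n θ) :
    conormal θ ξ ∈ tangent θ ξ ∧ ‖conormal θ ξ‖ = 1 ∧
      (∀ v ∈ tangent θ ξ, v (Fin.last n) = 0 → ⟪conormal θ ξ, v⟫_ℝ = 0) ∧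
      0 < ⟪conormal θ ξ, eDown n⟫_ℝ := by
  have hee : ⟪eDown n, eDown n⟫_ℝ = 1 := by simp [eDown, eLast]
  have he : ∀ x : Amb n, ⟪eDown n, x⟫_ℝ = -x (Fin.last n) := by
    intro x
    rw [eDown, inner_neg_left, inner_eLast]
  have he' : ∀ x : Amb n, ⟪x, eDown n⟫_ℝ = -x (Fin.last n) := by
    intro x
    rw [real_inner_comm, he]
  have hse : ⟪ξ, eDown n⟫_ℝ = 0 := by rw [he', hξ.2, neg_zero]
  have hes : ⟪eDown n, ξ⟫_ℝ = 0 := by rw [he, hξ.2, neg_zero]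
  have hss : ⟪ξ, ξ⟫_ℝ = Real.sin θ ^ 2 := by
    have h1 : ⟪nu θ ξ, nu θ ξ⟫_ℝ = 1 := by
      rw [real_inner_self_eq_norm_sq, norm_nu hξ.1, one_pow]
    simp only [nu, inner_sub_left, inner_sub_right, real_inner_smul_left, inner_smul_right, hee,
      hse, hes] at h1
    rw [Real.sin_sq]
    linarith
  refine ⟨?_, ?_, ?_, ?_⟩
  · rw [mem_tangent]
    simp only [nu, conormal, inner_sub_left, inner_add_right, real_inner_smul_left,
      inner_smul_right, hee, hse, hes, hss]
    field_simp
    ring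
  · have h1 : ‖conormal θ ξ‖ ^ 2 = 1 := by
      rw [← real_inner_self_eq_norm_sq]
      simp only [conormal, inner_add_left, inner_add_right, real_inner_smul_left,
        inner_smul_right, hee, hse, hes, hss]
      field_simp
      linarith [Real.sin_sq_add_cos_sq θ]
    nlinarith [norm_nonneg (conormal θ ξ)]
  · intro v hv hv0
    have h1 := mem_tangent.1 hv
    rw [nu, inner_sub_left, real_inner_smul_left, he, hv0, neg_zero, mul_zero, sub_zero] at h1
    rw [conormal, inner_add_left, real_inner_smul_left, real_inner_smul_left,
      real_inner_smul_left, h1, he, hv0]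
    simp
  · rw [conormal, inner_add_left, real_inner_smul_left, real_inner_smul_left,
      real_inner_smul_left, hee, hse]
    simpa using hθ

end Capillary

end

open scoped Topology

noncomputable section

namespace Capillary

/-! Central projection from the centre of the sphere turns the problem into one on a flat ball. With
`w x = ‖lift x‖ * h (chart θ x)` (`graphFun`), the restriction to the hyperplane at height one of
the 1-homogeneous extension of `h`, the gradient of `w` and `w - ⟪x, ∇w⟫` are the horizontal and
vertical parts of the support vector `hν + ∇h`. Hence the capillary equation becomes `det D²w = g
w^(p-1) (|∇w|² + (w - ⟪x, ∇w⟫)²)^s` on the ball of radius `R = tan θ`, with `s = (n+1-q)/2 ≥ 0`. The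
boundary condition says that the support vector is horizontal, that is, `⟪x, ∇w⟫ = w`
(`IsSolution.graphSolution`).

The weight `φ = (R² + |x|²)/2` satisfies the same Robin condition, so `v = w/φ` has zero normal
derivative. Put `Y = φ∇v = ∇w - v x` and maximise `|Y|²/v^γ`. The normal derivative of the test
function vanishes on the boundary, so a boundary maximum obeys the same first and second order
conditions as an interior one (`max_conditions`).

At the maximum the first order condition makes `Y` an eigenvector of `D²w`, with eigenvalue `λ`
given by `φλ = ⟪x, Y⟫ + vφ + γ|Y|²/(2v)`. The second order conditions in an eigenbasis, each divided
by its eigenvalue and summed, contain the third derivatives of `w` exactly as they occur in the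
logarithmic derivative of the equation along `Y`. The factor `w^(p-1)` contributes
`2(p-1)|Y|²/(φv)`, the terms `-2(λ - v)` contribute `-nγ|Y|²/(φv)` at leading order, and the dual
factor has a good sign once `|Y|` dominates `v`. What remains is `(2(p-1) - nγ)|Y| ≤ C v`
(`bound_at_max`); this is where `γ < 2(p-1)/n` enters, while `γ < 2` makes the remaining quadratic
term nonnegative for large `|Y|/v`.

So `|Y| ≤ K v` at the maximum, and `|Y|²/v^γ ≤ K² v^(2-γ)` there, which is controlled by `(max
w)^(2-γ)`. Since `|∇h|² + h²` is bounded by a multiple of `|Y|² + v²`, the estimate returns to the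
cap. -/

/-- The derivative of the determinant at an invertible diagonal matrix. -/
theorem hasDerivAt_det_of_diagonal {ι : Type*} [Fintype ι] [DecidableEq ι]
    {M : ℝ → Matrix ι ι ℝ} {M' : Matrix ι ι ℝ} {d : ι → ℝ} (h0 : M 0 = Matrix.diagonal d)
    (hd : ∀ i, d i ≠ 0) (hM : ∀ i j, HasDerivAt (fun t => M t i j) (M' i j) 0) :
    HasDerivAt (fun t => (M t).det) ((∏ i, d i) * ∑ i, (d i)⁻¹ * M' i i) 0 := by
  simp only [Matrix.det_apply]
  have h1 : ∀ σ : Equiv.Perm ι, HasDerivAt (fun t => ∏ i, M t (σ i) i)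
      (∑ i, (∏ j ∈ Finset.univ.erase i, M 0 (σ j) j) • M' (σ i) i) 0 := fun σ =>
    HasDerivAt.fun_finsetProd fun i _ => hM (σ i) i
  have h2 : HasDerivAt (fun t => ∑ σ : Equiv.Perm ι, Equiv.Perm.sign σ • ∏ i, M t (σ i) i)
      (∑ σ : Equiv.Perm ι, Equiv.Perm.sign σ •
        ∑ i, (∏ j ∈ Finset.univ.erase i, M 0 (σ j) j) • M' (σ i) i) 0 :=
    HasDerivAt.fun_sum fun σ _ => by
      simpa only [Units.smul_def, zsmul_eq_mul] using (h1 σ).const_mul _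
  convert h2 using 1
  -- Only the identity contributes: any other permutation moves at least two indices, so after one
  -- factor is differentiated an off-diagonal zero is left.
  rw [Finset.sum_eq_single (1 : Equiv.Perm ι)]
  · simp only [Equiv.Perm.sign_one, one_smul, Equiv.Perm.one_apply, h0, Matrix.diagonal_apply_eq,
      smul_eq_mul]
    rw [Finset.mul_sum]
    refine Finset.sum_congr rfl fun i _ => ?_
    rw [← Finset.mul_prod_erase Finset.univ d (Finset.mem_univ i)]
    field_simp [hd i]
  · intro σ _ hσ
    have hz : ∀ i, ∏ j ∈ Finset.univ.erase i, M 0 (σ j) j = 0 := by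
      intro i
      obtain ⟨j, hj, hji⟩ : ∃ j, σ j ≠ j ∧ j ≠ i := by
        by_contra! hcon
        apply hσ
        obtain ⟨k, hk⟩ : ∃ k, σ k ≠ k := by
          by_contra! hk
          exact hσ (Equiv.ext hk)
        have h3 := hcon k hk
        have h4 := hcon (σ k) (fun h => hk (σ.injective h))
        exact absurd (h4.trans h3.symm) hk
      refine Finset.prod_eq_zero (Finset.mem_erase.2 ⟨hji, Finset.mem_univ j⟩) ?_
      rw [h0, Matrix.diagonal_apply_ne _ hj]
    simp [hz]
  · simp

/-! ### Maximum conditions on a closed ball. -/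

/-- A one-sided second derivative test. -/
theorem second_deriv_nonpos_of_le_right {k k' : ℝ → ℝ} {c : ℝ}
    (hk : ∀ᶠ t in 𝓝 0, HasDerivAt k (k' t) t) (hk' : HasDerivAt k' c 0) (h0 : k' 0 = 0)
    (hle : ∀ᶠ t in 𝓝[>] 0, k t ≤ k 0) : c ≤ 0 := by
  by_contra! hc
  have h1 : ∀ᶠ t in 𝓝[>] (0 : ℝ), 0 < k' t := by
    have h := hk'.hasDerivWithinAt (s := Set.Ioi 0)
    rw [hasDerivWithinAt_iff_tendsto_slope' (by simp)] at h
    filter_upwards [h.eventually (lt_mem_nhds hc), self_mem_nhdsWithin] with t ht ht0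
    have ht0' : (0 : ℝ) < t := ht0
    rwa [slope_def_field, h0, sub_zero, sub_zero, div_pos_iff_of_pos_right ht0'] at ht
  obtain ⟨ε, hε, hε'⟩ := Metric.eventually_nhds_iff.1 hk
  obtain ⟨δ, hδ, hδ'⟩ := mem_nhdsGT_iff_exists_Ioo_subset.1 h1
  obtain ⟨η, hη, hη'⟩ := mem_nhdsGT_iff_exists_Ioo_subset.1 hle
  have hδ0 : (0 : ℝ) < δ := hδ
  have hη0 : (0 : ℝ) < η := hη
  set s := min ε (min δ η) / 2 with hs
  have hm : 0 < min ε (min δ η) := lt_min hε (lt_min hδ0 hη0)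
  have hs0 : 0 < s := by positivity
  have hsm : s < min ε (min δ η) := by rw [hs]; linarith
  have hsε : s < ε := hsm.trans_le (min_le_left _ _)
  have hsδ : s < δ := hsm.trans_le ((min_le_right _ _).trans (min_le_left _ _))
  have hsη : s < η := hsm.trans_le ((min_le_right _ _).trans (min_le_right _ _))
  have hd : ∀ t ∈ Set.Icc 0 s, HasDerivAt k (k' t) t := fun t ht => hε' (by
    rw [Real.dist_eq, sub_zero, abs_of_nonneg ht.1]
    exact ht.2.trans_lt hsε)
  have hmono : StrictMonoOn k (Set.Icc 0 s) := by
    refine strictMonoOn_of_deriv_pos (convex_Icc 0 s)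
      (fun t ht => (hd t ht).continuousAt.continuousWithinAt) fun t ht => ?_
    rw [interior_Icc] at ht
    rw [(hd t ⟨ht.1.le, ht.2.le⟩).deriv]
    exact hδ' ⟨ht.1, ht.2.trans hsδ⟩
  exact absurd (hmono ⟨le_rfl, hs0.le⟩ ⟨hs0.le, le_rfl⟩ hs0) (not_lt.2 (hη' ⟨hs0, hsη⟩))

section

variable {E : Type*} [NormedAddCommGroup E] [InnerProductSpace ℝ E]

/-- In the inward case the linear term of `‖x + t a‖² = ‖x‖² + 2t⟪x, a⟫ + t²‖a‖²` wins for small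
`t`. -/
theorem eventually_add_smul_mem_closedBall {R : ℝ} {x a : E} (hx : ‖x‖ ≤ R)
    (h : ‖x‖ < R ∨ ⟪x, a⟫_ℝ < 0) :
    ∀ᶠ t in 𝓝[>] (0 : ℝ), x + t • a ∈ Metric.closedBall (0 : E) R := by
  rcases h with h | h
  · have hc : ContinuousAt (fun t : ℝ => ‖x + t • a‖) 0 := by fun_prop
    have h1 := hc.eventually_lt_const (u := R) (by simpa using h)
    filter_upwards [nhdsWithin_le_nhds h1] with t ht
    simpa using ht.le
  · have hpos : 0 < -2 * ⟪x, a⟫_ℝ / (‖a‖ ^ 2 + 1) := by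
      apply div_pos
      · linarith
      · positivity
    filter_upwards [Ioo_mem_nhdsGT hpos] with t ht
    rw [mem_closedBall_zero_iff]
    have h1 := ht.2
    rw [lt_div_iff₀ (by positivity)] at h1
    have h2 : ‖x + t • a‖ ^ 2 ≤ ‖x‖ ^ 2 := by
      rw [norm_add_sq_real, inner_smul_right, norm_smul, Real.norm_of_nonneg ht.1.le]
      nlinarith [ht.1, sq_nonneg ‖a‖]
    exact (pow_le_pow_iff_left₀ (norm_nonneg _) (norm_nonneg _) two_ne_zero |>.1 h2).trans hx

/-- First and second order conditions at a maximum over a closed ball, when the normal derivative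
vanishes at the boundary. -/
theorem fderiv_eq_zero_and_second_nonpos {R : ℝ} (hR : 0 < R) {F : E → ℝ} {x : E}
    (hx : ‖x‖ ≤ R) (hF : ContDiffAt ℝ 2 F x)
    (hmax : ∀ y ∈ Metric.closedBall (0 : E) R, F y ≤ F x)
    (hbd : ‖x‖ = R → fderiv ℝ F x x = 0) :
    fderiv ℝ F x = 0 ∧ ∀ a, fderiv ℝ (fderiv ℝ F) x a a ≤ 0 := by
  have hd : ∀ᶠ y in 𝓝 x, DifferentiableAt ℝ F y := by
    filter_upwards [hF.eventually (by simp)] with y hy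
    exact hy.differentiableAt (by simp)
  have hd2 : DifferentiableAt ℝ (fderiv ℝ F) x :=
    (hF.fderiv_right (m := 1) (by norm_num)).differentiableAt (by simp)
  have hline : ∀ a : E, ∀ t : ℝ, HasDerivAt (fun t : ℝ => x + t • a) a t := fun a t => by
    simpa using ((hasDerivAt_id t).smul_const a).const_add x
  have hk : ∀ a : E, ∀ᶠ t in 𝓝 (0 : ℝ),
      HasDerivAt (fun t : ℝ => F (x + t • a)) (fderiv ℝ F (x + t • a) a) t := by
    intro a
    have hc : Filter.Tendsto (fun t : ℝ => x + t • a) (𝓝 0) (𝓝 x) := by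
      have : ContinuousAt (fun t : ℝ => x + t • a) 0 := by fun_prop
      simpa [ContinuousAt] using this
    filter_upwards [hc.eventually hd] with t ht
    exact ht.hasFDerivAt.comp_hasDerivAt t (hline a t)
  have hk2 : ∀ a : E, HasDerivAt (fun t : ℝ => fderiv ℝ F (x + t • a) a)
      (fderiv ℝ (fderiv ℝ F) x a a) 0 := by
    intro a
    have h1 : HasFDerivAt (fderiv ℝ F) (fderiv ℝ (fderiv ℝ F) x) (x + (0 : ℝ) • a) := by
      simpa using hd2.hasFDerivAt
    have h2 : HasDerivAt (fun t : ℝ => fderiv ℝ F (x + t • a)) (fderiv ℝ (fderiv ℝ F) x a) 0 :=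
      h1.comp_hasDerivAt (0 : ℝ) (hline a 0)
    have h3 := h2.clm_apply (hasDerivAt_const (0 : ℝ) a)
    rwa [map_zero, add_zero] at h3
  have hin : ∀ a : E, (‖x‖ < R ∨ ⟪x, a⟫_ℝ < 0) →
      ∀ᶠ t in 𝓝[>] (0 : ℝ), F (x + t • a) ≤ F (x + (0 : ℝ) • a) := by
    intro a ha
    filter_upwards [eventually_add_smul_mem_closedBall hx ha] with t ht
    simpa using hmax _ ht
  have hfst : ∀ a : E, (‖x‖ < R ∨ ⟪x, a⟫_ℝ < 0) → fderiv ℝ F x a ≤ 0 := by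
    intro a ha
    have h1 := ((hk a).self_of_nhds).hasDerivWithinAt (s := Set.Ioi 0)
    rw [hasDerivWithinAt_iff_tendsto_slope' (by simp)] at h1
    simp only [zero_smul, add_zero] at h1
    refine le_of_tendsto h1 ?_
    filter_upwards [hin a ha, self_mem_nhdsWithin] with t ht ht0
    rw [slope_def_field]
    exact div_nonpos_of_nonpos_of_nonneg (by linarith) (by simpa using (le_of_lt ht0))
  have hzero : ∀ a, fderiv ℝ F x a ≤ 0 := by
    intro a
    rcases hx.lt_or_eq with hlt | heq
    · exact hfst a (Or.inl hlt)
    -- Subtracting this multiple of `x` makes the inner product with `x` equal to `-1`, so the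
    -- direction points inward; the derivative is unchanged because it vanishes along `x`.
    · have h1 := hfst (a - ((⟪x, a⟫_ℝ + 1) / R ^ 2) • x) (Or.inr (by
        rw [inner_sub_right, inner_smul_right, real_inner_self_eq_norm_sq, heq,
          div_mul_cancel₀ _ (by positivity)]
        linarith))
      rwa [map_sub, map_smul, hbd heq, smul_zero, sub_zero] at h1
  have hD : fderiv ℝ F x = 0 := by
    ext a
    have h1 := hzero (-a)
    rw [map_neg] at h1
    exact le_antisymm (hzero a) (by simpa using h1)
  have hsnd : ∀ a : E, (‖x‖ < R ∨ ⟪x, a⟫_ℝ < 0) → fderiv ℝ (fderiv ℝ F) x a a ≤ 0 :=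
    fun a ha => second_deriv_nonpos_of_le_right (hk a) (hk2 a) (by simp [hD]) (hin a ha)
  have hsnd' : ∀ a : E, (‖x‖ < R ∨ ⟪x, a⟫_ℝ ≠ 0) → fderiv ℝ (fderiv ℝ F) x a a ≤ 0 := by
    rintro a (ha | ha)
    · exact hsnd a (Or.inl ha)
    rcases ha.lt_or_gt with ha | ha
    · exact hsnd a (Or.inr ha)
    · simpa using hsnd (-a) (Or.inr (by rw [inner_neg_right]; linarith))
  refine ⟨hD, fun a => ?_⟩
  rcases hx.lt_or_eq with hlt | heq
  · exact hsnd' a (Or.inl hlt)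
  -- The line in a tangential direction leaves the ball, so the inequality is obtained as the limit
  -- of the directions `a + s x`, `s ≠ 0`.
  by_cases ha : ⟪x, a⟫_ℝ = 0
  · have hc : ContinuousAt
        (fun s : ℝ => fderiv ℝ (fderiv ℝ F) x (a + s • x) (a + s • x)) 0 := by fun_prop
    have h1 : Filter.Tendsto (fun s : ℝ => fderiv ℝ (fderiv ℝ F) x (a + s • x) (a + s • x))
        (𝓝[≠] 0) (𝓝 (fderiv ℝ (fderiv ℝ F) x a a)) := by
      simpa [ContinuousAt] using hc.tendsto.mono_left nhdsWithin_le_nhds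
    refine le_of_tendsto h1 ?_
    filter_upwards [self_mem_nhdsWithin] with s hs
    refine hsnd' _ (Or.inr ?_)
    rw [inner_add_right, ha, zero_add, inner_smul_right, real_inner_self_eq_norm_sq, heq]
    exact mul_ne_zero hs (by positivity)
  · exact hsnd' a (Or.inr ha)

end

end Capillary

end

noncomputable section

theorem HasFDerivAt.hasDerivAt_line {E F : Type*} [NormedAddCommGroup E] [NormedSpace ℝ E]
    [NormedAddCommGroup F] [NormedSpace ℝ F] {f : E → F} {f' : E →L[ℝ] F} {x : E}
    (h : HasFDerivAt f f' x) (a : E) : HasDerivAt (fun t : ℝ => f (x + t • a)) (f' a) 0 := by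
  have hline : HasDerivAt (fun t : ℝ => x + t • a) a 0 := by
    simpa using ((hasDerivAt_id (0 : ℝ)).smul_const a).const_add x
  have hx0 : x + (0 : ℝ) • a = x := by simp
  rw [← hx0] at h
  exact h.comp_hasDerivAt (0 : ℝ) hline

theorem HasFDerivAt.hasDerivAt_line_apply {E F G : Type*} [NormedAddCommGroup E] [NormedSpace ℝ E]
    [NormedAddCommGroup F] [NormedSpace ℝ F] [NormedAddCommGroup G] [NormedSpace ℝ G]
    {f : E → F →L[ℝ] G} {f' : E →L[ℝ] F →L[ℝ] G} {x : E} (h : HasFDerivAt f f' x) (a : E) (b : F) :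
    HasDerivAt (fun t : ℝ => f (x + t • a) b) (f' a b) 0 := by
  have h1 := (h.hasDerivAt_line a).clm_apply (hasDerivAt_const (0 : ℝ) b)
  rwa [map_zero, add_zero] at h1

namespace Capillary

/-! ### Scalar inequalities at the maximum. -/

/-- The second order condition in an eigendirection, after the third derivative of the unknown is
isolated and the first order condition is inserted. -/
theorem eigendirection_inequality {φ v y2 xY γ lam L z X d2 third : ℝ} (hφ : 0 < φ) (hv : 0 < v)
    (hy : 0 < y2) (hL : 0 < L) (hlam : φ * lam = xY + v * φ + γ * y2 / (2 * v))
    (hσ : v ≤ lam) (hfirst : (φ * L - xY - v * φ) * z = γ * y2 / (2 * v) * z)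
    (hcs : (γ * y2 * z / (2 * v)) ^ 2 ≤ d2 * y2)
    (hsecond : 2 * d2 + 2 * (third - (L - 2 * z * X - v) / φ * xY - 2 * z * (φ * z))
      - γ * y2 / v * ((γ - 1) / v * z ^ 2 + (L - 2 * z * X - v) / φ) ≤ 0) :
    2 * (third / L) + ((γ - γ ^ 2 / 2) * y2 / v ^ 2 - 4 * φ) * (z ^ 2 / lam) - 2 * (lam - v)
      + 4 * (lam - v) * (X * z / lam) ≤ 0 := by
  have hlam0 : 0 < lam := hv.trans_le hσ
  have hxY : xY = φ * lam - v * φ - γ * y2 / (2 * v) := by linarith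
  -- Cauchy–Schwarz keeps part of the squared derivative of `Y`; combined with the term in `γ * (γ -
  -- 1)` it leaves the coefficient `γ - γ²/2`, positive for `0 < γ < 2`.
  have hd2 : γ ^ 2 * y2 * z ^ 2 / (4 * v ^ 2) ≤ d2 := by
    have h1 : (γ * y2 * z / (2 * v)) ^ 2 = γ ^ 2 * y2 * z ^ 2 / (4 * v ^ 2) * y2 := by
      field_simp
      ring
    rw [h1] at hcs
    exact le_of_mul_le_mul_right hcs hy
  have hmain : 2 * third + ((γ - γ ^ 2 / 2) * y2 / v ^ 2 - 4 * φ) * z ^ 2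
      - 2 * (lam - v) * (L - 2 * z * X - v) ≤ 0 := by
    have h1 : 2 * d2 + 2 * (third - (L - 2 * z * X - v) / φ * xY - 2 * z * (φ * z))
        - γ * y2 / v * ((γ - 1) / v * z ^ 2 + (L - 2 * z * X - v) / φ) =
        2 * third + ((γ - γ ^ 2 / 2) * y2 / v ^ 2 - 4 * φ) * z ^ 2
        - 2 * (lam - v) * (L - 2 * z * X - v) + 2 * (d2 - γ ^ 2 * y2 * z ^ 2 / (4 * v ^ 2)) := by
      rw [hxY]
      field_simp
      ring
    linarith
  -- Where `z ≠ 0` the first order condition forces `L = lam`, so the terms carrying `z` can be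
  -- divided by a common eigenvalue before summation.
  have hzL : z / L = z / lam := by
    by_cases hz : z = 0
    · simp [hz]
    · have h1 := mul_right_cancel₀ hz hfirst
      have h2 : φ * L = φ * lam := by linarith
      rw [mul_left_cancel₀ hφ.ne' h2]
  have h1 : z ^ 2 / lam = z ^ 2 / L := by rw [sq, mul_div_assoc, mul_div_assoc, hzL]
  have h2 : X * z / lam = X * z / L := by rw [mul_div_assoc, mul_div_assoc, hzL]
  rw [h1, h2]
  have h3 : (2 * third + ((γ - γ ^ 2 / 2) * y2 / v ^ 2 - 4 * φ) * z ^ 2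
      - 2 * (lam - v) * (L - 2 * z * X - v)) / L ≤ 0 :=
    div_nonpos_of_nonpos_of_nonneg hmain hL.le
  have h4 : 0 ≤ 2 * (lam - v) * v / L := by
    have : 0 ≤ lam - v := sub_nonneg.2 hσ
    positivity
  have h5 : 2 * (third / L) + ((γ - γ ^ 2 / 2) * y2 / v ^ 2 - 4 * φ) * (z ^ 2 / L) - 2 * (lam - v)
      + 4 * (lam - v) * (X * z / L) = (2 * third + ((γ - γ ^ 2 / 2) * y2 / v ^ 2 - 4 * φ) * z ^ 2
      - 2 * (lam - v) * (L - 2 * z * X - v)) / L - 2 * (lam - v) * v / L := by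
    field_simp
    ring
  rw [h5]
  linarith

/-- The gradient bound at a maximum, from the summed second order condition. -/
theorem bound_of_summed_inequality {φ v y lam xY γ n p R Cg T gY S : ℝ} (hφ : 0 < φ) (hv : 0 < v)
    (hy : 0 < y) (hn : 0 ≤ n) (hp : 1 < p) (hφR : φ ≤ R ^ 2) (hσ : v ≤ lam)
    (hlam : φ * lam = xY + v * φ + γ * y ^ 2 / (2 * v)) (hS : 0 ≤ S) (hCg : 0 ≤ Cg)
    (hκ : 4 * φ * v ^ 2 ≤ (γ - γ ^ 2 / 2) * y ^ 2)
    (hgY : |gY| ≤ Cg * y) (hxY : |xY| ≤ R * y)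
    (hT : gY + (p - 1) * ((y ^ 2 + v * xY) / (φ * v)) ≤ T)
    (hineq : 2 * T + ((γ - γ ^ 2 / 2) * y ^ 2 / v ^ 2 - 4 * φ) * (S / lam) - n * (2 * (lam - v))
      + 4 * (lam - v) * (xY / φ / lam) ≤ 0) :
    (2 * (p - 1) - n * γ) * y ≤ (2 * Cg * R ^ 2 + (2 * (p - 1) + 2 * n + 4) * R) * v := by
  have hlam0 : 0 < lam := hv.trans_le hσ
  have h1 : 0 ≤ ((γ - γ ^ 2 / 2) * y ^ 2 / v ^ 2 - 4 * φ) * (S / lam) := by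
    refine mul_nonneg ?_ (div_nonneg hS hlam0.le)
    rw [sub_nonneg, le_div_iff₀ (by positivity)]
    exact hκ
  -- Since `0 ≤ (lam - v) / lam ≤ 1`, this term is only linear in `y`, although `lam` grows
  -- quadratically.
  have h2 : -(4 * (R * y / φ)) ≤ 4 * (lam - v) * (xY / φ / lam) := by
    have h3 : 4 * (lam - v) * (xY / φ / lam) = 4 * ((lam - v) / lam * (xY / φ)) := by
      field_simp
    have h4 : |(lam - v) / lam * (xY / φ)| ≤ 1 * (R * y / φ) := by
      rw [abs_mul]
      refine mul_le_mul ?_ ?_ (abs_nonneg _) zero_le_one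
      · rw [abs_of_nonneg (div_nonneg (sub_nonneg.2 hσ) hlam0.le), div_le_one hlam0]
        linarith
      · rw [abs_div, abs_of_pos hφ]
        gcongr
    rw [h3]
    linarith [(abs_le.1 h4).1]
  have h5 : 2 * (lam - v) = (2 * xY + γ * y ^ 2 / v) / φ := by
    rw [eq_div_iff hφ.ne']
    field_simp at hlam ⊢
    linarith
  have h6 : 2 * gY + 2 * (p - 1) * ((y ^ 2 + v * xY) / (φ * v))
      - n * ((2 * xY + γ * y ^ 2 / v) / φ) - 4 * (R * y / φ) ≤ 0 := by
    rw [h5] at hineq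
    linarith
  have h7 : 2 * gY + 2 * (p - 1) * ((y ^ 2 + v * xY) / (φ * v))
      - n * ((2 * xY + γ * y ^ 2 / v) / φ) - 4 * (R * y / φ) =
      ((2 * (p - 1) - n * γ) * y ^ 2 - v * (-(2 * φ * gY) - 2 * (p - 1) * xY + 2 * n * xY
        + 4 * R * y)) / (φ * v) := by
    field_simp
    ring
  rw [h7, div_le_iff₀ (by positivity), zero_mul, sub_nonpos] at h6
  have h8 : -(2 * φ * gY) - 2 * (p - 1) * xY + 2 * n * xY + 4 * R * y ≤
      (2 * Cg * R ^ 2 + (2 * (p - 1) + 2 * n + 4) * R) * y := by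
    obtain ⟨hg1, hg2⟩ := abs_le.1 hgY
    obtain ⟨hx1, hx2⟩ := abs_le.1 hxY
    have h9 : φ * -gY ≤ R ^ 2 * (Cg * y) :=
      (mul_le_mul_of_nonneg_left (by linarith : -gY ≤ Cg * y) hφ.le).trans
        (mul_le_mul_of_nonneg_right hφR (by positivity))
    have h10 : (p - 1) * -xY ≤ (p - 1) * (R * y) :=
      mul_le_mul_of_nonneg_left (by linarith) (by linarith)
    have h11 : n * xY ≤ n * (R * y) := mul_le_mul_of_nonneg_left hx2 hn
    linarith
  have h12 := h6.trans (mul_le_mul_of_nonneg_left h8 hv.le)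
  refine le_of_mul_le_mul_right (le_of_eq_of_le ?_ (h12.trans_eq ?_)) hy
  · ring
  · ring

/-! ### Derivatives of the test function, of the weighted quotient and of its gradient. -/

section

variable {E : Type*} [NormedAddCommGroup E] [InnerProductSpace ℝ E] [CompleteSpace E]

theorem fderiv_fderiv_normSq_sub_rpow {Y : E → E} {v : E → ℝ} {Y' : E → E →L[ℝ] E}
    {Y'' : E →L[ℝ] E →L[ℝ] E} {V : E → E} {V' : E →L[ℝ] E} {x : E} {m γ : ℝ}
    (hY : ∀ z, HasFDerivAt Y (Y' z) z) (hY' : HasFDerivAt Y' Y'' x)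
    (hv : ∀ z, HasGradientAt v (V z) z) (hV : HasFDerivAt V V' x) (hvx : 0 < v x)
    (hF : DifferentiableAt ℝ (fderiv ℝ fun z => ‖Y z‖ ^ 2 - m * v z ^ γ) x) (a : E) :
    fderiv ℝ (fun z => ‖Y z‖ ^ 2 - m * v z ^ γ) x a =
      2 * ⟪Y x, Y' x a⟫_ℝ - m * (γ * v x ^ (γ - 1) * ⟪V x, a⟫_ℝ) ∧
    fderiv ℝ (fderiv ℝ fun z => ‖Y z‖ ^ 2 - m * v z ^ γ) x a a =
      2 * ‖Y' x a‖ ^ 2 + 2 * ⟪Y x, Y'' a a⟫_ℝ - m * (γ * ((γ - 1) * v x ^ (γ - 2) * ⟪V x, a⟫_ℝ ^ 2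
        + v x ^ (γ - 1) * ⟪V' a, a⟫_ℝ)) := by
  have hfst : ∀ z, 0 < v z → fderiv ℝ (fun z => ‖Y z‖ ^ 2 - m * v z ^ γ) z a =
      2 * ⟪Y z, Y' z a⟫_ℝ - m * (γ * v z ^ (γ - 1) * ⟪V z, a⟫_ℝ) := by
    intro z hz
    have h1 := (hY z).norm_sq
    have h2 := ((hv z).hasFDerivAt.rpow_const (p := γ) (Or.inl hz.ne')).const_mul m
    rw [(h1.fun_sub h2).fderiv]
    simp [mul_assoc]
  refine ⟨hfst x hvx, ?_⟩
  have hx0 : x + (0 : ℝ) • a = x := by simp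
  have hc : Filter.Tendsto (fun t : ℝ => x + t • a) (𝓝 0) (𝓝 x) := by
    have : ContinuousAt (fun t : ℝ => x + t • a) 0 := by fun_prop
    simpa [ContinuousAt] using this
  have hev : ∀ᶠ t in 𝓝 (0 : ℝ), 0 < v (x + t • a) :=
    hc.eventually ((hv x).hasFDerivAt.continuousAt.eventually_const_lt hvx)
  have h1 := hF.hasFDerivAt.hasDerivAt_line_apply a a
  have hYl := (hY x).hasDerivAt_line a
  have hY'l := hY'.hasDerivAt_line_apply a a
  have hvl := (hv x).hasFDerivAt.hasDerivAt_line a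
  have hVl := (hV.hasDerivAt_line a).inner ℝ (hasDerivAt_const (0 : ℝ) a)
  have h4 : HasDerivAt (fun t : ℝ => 2 * ⟪Y (x + t • a), Y' (x + t • a) a⟫_ℝ
      - m * (γ * v (x + t • a) ^ (γ - 1) * ⟪V (x + t • a), a⟫_ℝ)) _ 0 :=
    ((hYl.inner ℝ hY'l).const_mul 2).sub
      ((((hvl.rpow_const (p := γ - 1) (Or.inl (by rw [hx0]; exact hvx.ne'))).const_mul
        γ).mul hVl).const_mul m)
  have h5 := h1.unique (h4.congr_of_eventuallyEq (hev.mono fun t ht => hfst _ ht))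
  rw [h5]
  simp only [hx0, real_inner_self_eq_norm_sq, InnerProductSpace.toDual_apply_apply, inner_zero_right, zero_add]
  rw [show γ - 1 - 1 = γ - 2 by ring]
  ring

end

theorem two_le_infty : (2 : WithTop ℕ∞) ≤ ∞ := by
  exact WithTop.coe_le_coe.2 (le_top : (2 : ℕ∞) ≤ ⊤)

section

variable {E : Type*} [NormedAddCommGroup E] [InnerProductSpace ℝ E] [CompleteSpace E]

theorem contDiff_gradient {w : E → ℝ} (hw : ContDiff ℝ ∞ w) : ContDiff ℝ ∞ (gradient w) :=
  (InnerProductSpace.toDual ℝ E).symm.contDiff.comp (hw.fderiv_right (m := ∞) (by simp))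

theorem hasGradientAt_gradient {w : E → ℝ} (hw : ContDiff ℝ ∞ w) (x : E) :
    HasGradientAt w (gradient w x) x :=
  (hw.differentiable (by simp) x).hasGradientAt

theorem hasFDerivAt_gradient {w : E → ℝ} (hw : ContDiff ℝ ∞ w) (x : E) :
    HasFDerivAt (gradient w) (fderiv ℝ (gradient w) x) x :=
  ((contDiff_gradient hw).differentiable (by simp) x).hasFDerivAt

theorem contDiff_hessian {w : E → ℝ} (hw : ContDiff ℝ ∞ w) :
    ContDiff ℝ ∞ (fderiv ℝ (gradient w)) :=
  (contDiff_gradient hw).fderiv_right (m := ∞) (by simp)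

theorem hasFDerivAt_hessian {w : E → ℝ} (hw : ContDiff ℝ ∞ w) (x : E) :
    HasFDerivAt (fderiv ℝ (gradient w)) (fderiv ℝ (fderiv ℝ (gradient w)) x) x :=
  ((contDiff_hessian hw).differentiable (by simp) x).hasFDerivAt

theorem inner_hessian_comm {w : E → ℝ} (hw : ContDiff ℝ ∞ w) (x a b : E) :
    ⟪fderiv ℝ (gradient w) x a, b⟫_ℝ = ⟪fderiv ℝ (gradient w) x b, a⟫_ℝ := by
  have h : ∀ a b, fderiv ℝ (fderiv ℝ w) x a b = ⟪fderiv ℝ (gradient w) x a, b⟫_ℝ := by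
    intro a b
    have h1 := (((hw.fderiv_right (m := ∞) (by simp)).differentiable (by simp)
      x).hasFDerivAt).hasDerivAt_line_apply a b
    have h2 := ((hasFDerivAt_gradient hw x).hasDerivAt_line a).inner ℝ
      (hasDerivAt_const (0 : ℝ) b)
    simp only [inner_gradient_left, inner_zero_right, zero_add] at h2
    exact h1.unique h2
  rw [← h, ← h]
  exact (hw.contDiffAt.isSymmSndFDerivAt (by simpa using two_le_infty)).eq a b

/-- Full symmetry of the third derivative. It moves `Y` into the differentiation slot, where the
differentiated equation can be used. -/
theorem inner_third_deriv_comm {w : E → ℝ} (hw : ContDiff ℝ ∞ w) (x a b : E) :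
    ⟪b, fderiv ℝ (fderiv ℝ (gradient w)) x a a⟫_ℝ =
      ⟪a, fderiv ℝ (fderiv ℝ (gradient w)) x b a⟫_ℝ := by
  have h : ∀ a b c, ⟪fderiv ℝ (fderiv ℝ (gradient w)) x a b, c⟫_ℝ =
      ⟪fderiv ℝ (fderiv ℝ (gradient w)) x a c, b⟫_ℝ := by
    intro a b c
    have h1 : ∀ b c, HasDerivAt (fun t : ℝ => ⟪fderiv ℝ (gradient w) (x + t • a) b, c⟫_ℝ)
        ⟪fderiv ℝ (fderiv ℝ (gradient w)) x a b, c⟫_ℝ 0 := by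
      intro b c
      simpa using ((hasFDerivAt_hessian hw x).hasDerivAt_line_apply a b).inner ℝ
        (hasDerivAt_const (0 : ℝ) c)
    have h2 := h1 b c
    simp only [fun t : ℝ => inner_hessian_comm hw (x + t • a) b c] at h2
    exact h2.unique (h1 c b)
  rw [real_inner_comm, h,
    ((contDiff_gradient hw).contDiffAt.isSymmSndFDerivAt (by simpa using two_le_infty)).eq a b, real_inner_comm]

/-- The weight `(R² + |x|²) / 2`, whose normal derivative on the sphere of radius `R` is `R`. -/
def weight (R : ℝ) (x : E) : ℝ := (R ^ 2 + ‖x‖ ^ 2) / 2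

/-- The quotient of `w` by the weight. -/
def weightedQuot (R : ℝ) (w : E → ℝ) (x : E) : ℝ := w x / weight R x

/-- The weight times the gradient of `weightedQuot R w`. -/
def shiftedGrad (R : ℝ) (w : E → ℝ) (x : E) : E := gradient w x - weightedQuot R w x • x

theorem weight_pos {E : Type*} [NormedAddCommGroup E] {R : ℝ} (hR : 0 < R) (x : E) : 0 < weight R x := by
  rw [weight]
  positivity

theorem hasGradientAt_weight (R : ℝ) (x : E) : HasGradientAt (weight R) x x := by
  rw [hasGradientAt_iff_hasFDerivAt]
  have h1 := (((hasFDerivAt_id x).norm_sq).const_add (R ^ 2)).mul_const (2⁻¹ : ℝ)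
  simp only [id_eq] at h1
  have h2 : HasFDerivAt (weight R) _ x := h1
  refine h2.congr_fderiv ?_
  ext a
  simp

theorem contDiff_weight {E : Type*} [NormedAddCommGroup E] [InnerProductSpace ℝ E] (R : ℝ) : ContDiff ℝ ∞ (weight (E := E) R) := by
  unfold weight
  exact (contDiff_const.add (contDiff_norm_sq ℝ)).div_const 2

theorem contDiff_weightedQuot {E : Type*} [NormedAddCommGroup E] [InnerProductSpace ℝ E] {R : ℝ} (hR : 0 < R) {w : E → ℝ} (hw : ContDiff ℝ ∞ w) :
    ContDiff ℝ ∞ (weightedQuot R w) :=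
  hw.div (contDiff_weight R) fun x => (weight_pos hR x).ne'

theorem contDiff_shiftedGrad {R : ℝ} (hR : 0 < R) {w : E → ℝ} (hw : ContDiff ℝ ∞ w) :
    ContDiff ℝ ∞ (shiftedGrad R w) :=
  (contDiff_gradient hw).sub ((contDiff_weightedQuot hR hw).smul contDiff_id)

theorem hasGradientAt_weightedQuot {R : ℝ} (hR : 0 < R) {w : E → ℝ} (hw : ContDiff ℝ ∞ w)
    (x : E) : HasGradientAt (weightedQuot R w) ((weight R x)⁻¹ • shiftedGrad R w x) x := by
  rw [hasGradientAt_iff_hasFDerivAt]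
  have hne := (weight_pos hR x).ne'
  have h1 := (hasGradientAt_gradient hw x).hasFDerivAt.mul
    ((hasDerivAt_inv hne).comp_hasFDerivAt x (hasGradientAt_weight R x).hasFDerivAt)
  have h2 : HasFDerivAt (weightedQuot R w) _ x := h1
  refine h2.congr_fderiv ?_
  ext a
  simp only [shiftedGrad, weightedQuot, InnerProductSpace.toDual_apply_apply, inner_sub_left,
    real_inner_smul_left, smul_apply, add_apply, smul_eq_mul, Function.comp_apply]
  field_simp
  ring

theorem fderiv_shiftedGrad {R : ℝ} (hR : 0 < R) {w : E → ℝ} (hw : ContDiff ℝ ∞ w) (x a : E) :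
    fderiv ℝ (shiftedGrad R w) x a = fderiv ℝ (gradient w) x a
      - ⟪(weight R x)⁻¹ • shiftedGrad R w x, a⟫_ℝ • x - weightedQuot R w x • a := by
  have h1 := (hasFDerivAt_gradient hw x).sub
    ((hasGradientAt_weightedQuot hR hw x).hasFDerivAt.smul (hasFDerivAt_id x))
  have h2 : HasFDerivAt (shiftedGrad R w) _ x := h1
  rw [h2.fderiv]
  simp only [sub_apply, add_apply, smul_apply, ContinuousLinearMap.smulRight_apply,
    InnerProductSpace.toDual_apply_apply, ContinuousLinearMap.id_apply, id_eq]
  abel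

theorem fderiv_fderiv_shiftedGrad {R : ℝ} (hR : 0 < R) {w : E → ℝ} (hw : ContDiff ℝ ∞ w)
    (x a : E) :
    fderiv ℝ (fderiv ℝ (shiftedGrad R w)) x a a = fderiv ℝ (fderiv ℝ (gradient w)) x a a
      - ⟪fderiv ℝ (fun z => (weight R z)⁻¹ • shiftedGrad R w z) x a, a⟫_ℝ • x
      - (2 * ⟪(weight R x)⁻¹ • shiftedGrad R w x, a⟫_ℝ) • a := by
  have hV : ContDiff ℝ ∞ fun z => (weight R z)⁻¹ • shiftedGrad R w z :=
    ((contDiff_weight R).inv fun z => (weight_pos hR z).ne').smul (contDiff_shiftedGrad hR hw)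
  have h1 := ((((contDiff_shiftedGrad hR hw).fderiv_right (m := ∞) (by simp)).differentiable
    (by simp) x).hasFDerivAt).hasDerivAt_line_apply a a
  simp only [fun t : ℝ => fderiv_shiftedGrad hR hw (x + t • a) a] at h1
  have hVl := (((hV.differentiable (by simp) x).hasFDerivAt).hasDerivAt_line a).inner ℝ
    (hasDerivAt_const (0 : ℝ) a)
  have hxl : HasDerivAt (fun t : ℝ => x + t • a) a 0 := (hasFDerivAt_id x).hasDerivAt_line a
  have hvl := ((hasGradientAt_weightedQuot hR hw x).hasFDerivAt).hasDerivAt_line a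
  have h2 := (((hasFDerivAt_hessian hw x).hasDerivAt_line_apply a a).sub
    (hVl.smul hxl)).sub (hvl.smul_const a)
  have h3 := h1.unique h2
  rw [h3]
  simp only [inner_zero_right, zero_add, zero_smul, add_zero,
    InnerProductSpace.toDual_apply_apply, two_mul, add_smul]
  abel

/-- Comes from differentiating the product `φ∇v = Y`, so no second derivative of a quotient has to
be expanded. -/
theorem weight_mul_inner_fderiv {R : ℝ} (hR : 0 < R) {w : E → ℝ} (hw : ContDiff ℝ ∞ w)
    (x a : E) :
    weight R x * ⟪fderiv ℝ (fun z => (weight R z)⁻¹ • shiftedGrad R w z) x a, a⟫_ℝ =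
      ⟪fderiv ℝ (gradient w) x a, a⟫_ℝ
        - 2 * ⟪(weight R x)⁻¹ • shiftedGrad R w x, a⟫_ℝ * ⟪x, a⟫_ℝ
        - weightedQuot R w x * ‖a‖ ^ 2 := by
  have hV : ContDiff ℝ ∞ fun z => (weight R z)⁻¹ • shiftedGrad R w z :=
    ((contDiff_weight R).inv fun z => (weight_pos hR z).ne').smul (contDiff_shiftedGrad hR hw)
  have h1 : HasFDerivAt (fun z => weight R z • ((weight R z)⁻¹ • shiftedGrad R w z)) _ x :=
    (hasGradientAt_weight R x).hasFDerivAt.smul (hV.differentiable (by simp) x).hasFDerivAt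
  simp only [fun z => smul_inv_smul₀ (weight_pos hR z).ne' (shiftedGrad R w z)] at h1
  have h2 := congrArg (fun L : E →L[ℝ] E => ⟪L a, a⟫_ℝ) h1.fderiv
  simp only [fderiv_shiftedGrad hR hw, inner_sub_left, real_inner_smul_left, add_apply, smul_apply,
    ContinuousLinearMap.smulRight_apply, InnerProductSpace.toDual_apply_apply,
    inner_add_left, real_inner_self_eq_norm_sq] at h2
  simp only [real_inner_smul_left]
  linarith

end

/-! ### Determinants in an orthonormal basis, and the differentiated equation and boundary
condition. -/

section

variable {E : Type*} [NormedAddCommGroup E] [InnerProductSpace ℝ E]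

theorem det_eq_det_inner {ι : Type*} [Fintype ι] [DecidableEq ι] (b : OrthonormalBasis ι ℝ E)
    (L : E →ₗ[ℝ] E) : LinearMap.det L = (Matrix.of fun i j => ⟪b i, L (b j)⟫_ℝ).det := by
  rw [← LinearMap.det_toMatrix b.toBasis]
  congr 1
  ext i j
  simp [LinearMap.toMatrix_apply, OrthonormalBasis.repr_apply_apply]

theorem differentiableAt_det [FiniteDimensional ℝ E] {A : E → E →L[ℝ] E} {x : E}
    (hA : DifferentiableAt ℝ A x) :
    DifferentiableAt ℝ (fun z => LinearMap.det (A z : E →ₗ[ℝ] E)) x := by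
  simp only [det_eq_det_inner (stdOrthonormalBasis ℝ E), Matrix.det_apply, Matrix.of_apply,
    Units.smul_def, zsmul_eq_mul, ContinuousLinearMap.coe_coe]
  refine DifferentiableAt.fun_sum fun σ _ => DifferentiableAt.const_mul ?_ _
  have h : ∀ i j, DifferentiableAt ℝ (fun z => ⟪stdOrthonormalBasis ℝ E i,
      A z (stdOrthonormalBasis ℝ E j)⟫_ℝ) x := fun i j =>
    (differentiableAt_const _).inner ℝ (hA.clm_apply (differentiableAt_const _))
  exact (HasFDerivAt.finsetProd fun i _ => (h (σ i) i).hasFDerivAt).differentiableAt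

theorem hasDerivAt_det_line {ι : Type*} [Fintype ι] [DecidableEq ι] {A : E → E →L[ℝ] E}
    {A' : E →L[ℝ] E →L[ℝ] E} {x : E} (hA : HasFDerivAt A A' x) (b : OrthonormalBasis ι ℝ E)
    {d : ι → ℝ} (hd : ∀ i, A x (b i) = d i • b i) (hd0 : ∀ i, d i ≠ 0) (Y : E) :
    HasDerivAt (fun t : ℝ => LinearMap.det (A (x + t • Y) : E →ₗ[ℝ] E))
      ((∏ i, d i) * ∑ i, (d i)⁻¹ * ⟪b i, A' Y (b i)⟫_ℝ) 0 := by
  simp only [det_eq_det_inner b, ContinuousLinearMap.coe_coe]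
  refine hasDerivAt_det_of_diagonal (M := fun t => Matrix.of fun i j => ⟪b i, A (x + t • Y) (b j)⟫_ℝ)
    (M' := Matrix.of fun i j => ⟪b i, A' Y (b j)⟫_ℝ) ?_ hd0 fun i j => ?_
  · ext i j
    simp [hd, inner_smul_right, orthonormal_iff_ite.1 b.orthonormal, Matrix.diagonal_apply]
    split_ifs with hij
    · rw [hij]
    · rfl
  · simpa using (hasDerivAt_const (0 : ℝ) (b i)).inner ℝ (hA.hasDerivAt_line_apply Y (b j))

theorem det_eq_prod_of_eigenbasis {ι : Type*} [Fintype ι] [DecidableEq ι] {L : E →L[ℝ] E}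
    (b : OrthonormalBasis ι ℝ E) {d : ι → ℝ} (hd : ∀ i, L (b i) = d i • b i) :
    LinearMap.det (L : E →ₗ[ℝ] E) = ∏ i, d i := by
  rw [det_eq_det_inner b, ← Matrix.det_diagonal]
  congr 1
  ext i j
  simp [hd, inner_smul_right, orthonormal_iff_ite.1 b.orthonormal, Matrix.diagonal_apply]
  split_ifs with hij
  · rw [hij]
  · rfl

/-- Functions that agree on a closed ball have the same derivative there. -/
theorem fderiv_eq_of_eq_on_closedBall {R : ℝ} (hR : 0 < R) {f₁ f₂ : E → ℝ} {x : E}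
    (h₁ : DifferentiableAt ℝ f₁ x) (h₂ : DifferentiableAt ℝ f₂ x)
    (h : ∀ z, ‖z‖ ≤ R → f₁ z = f₂ z) (hx : ‖x‖ ≤ R) : fderiv ℝ f₁ x = fderiv ℝ f₂ x := by
  -- A convex set with nonempty interior determines the derivative at its boundary points as well;
  -- the equation can thus be differentiated up to the boundary.
  have hu : UniqueDiffWithinAt ℝ (Metric.closedBall (0 : E) R) x := by
    refine uniqueDiffOn_convex (convex_closedBall _ _) ?_ x (by simpa using hx)
    exact ⟨0, interior_mono Metric.ball_subset_closedBall
      (by rw [Metric.isOpen_ball.interior_eq]; exact Metric.mem_ball_self hR)⟩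
  rw [← h₁.fderivWithin hu, ← h₂.fderivWithin hu]
  exact fderivWithin_congr (fun z hz => h z (by simpa using hz)) (h x hx)

end

/-- The convex solutions on a ball of the Monge–Ampère equation that the capillary `L_p` dual
Minkowski equation becomes in the central projection, with its Robin boundary condition. -/
structure GraphSolution {E : Type*} [NormedAddCommGroup E] [InnerProductSpace ℝ E]
    [CompleteSpace E] (R p s : ℝ) (g w : E → ℝ) : Prop where
  smooth : ContDiff ℝ ∞ w
  pos : ∀ x, ‖x‖ ≤ R → 0 < w x
  posDef : ∀ x, ‖x‖ ≤ R → ∀ a, a ≠ 0 → 0 < ⟪fderiv ℝ (gradient w) x a, a⟫_ℝ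
  equation : ∀ x, ‖x‖ ≤ R → LinearMap.det (fderiv ℝ (gradient w) x : E →ₗ[ℝ] E) =
    g x * w x ^ (p - 1) * (‖gradient w x‖ ^ 2 + (w x - ⟪x, gradient w x⟫_ℝ) ^ 2) ^ s
  boundary : ∀ x, ‖x‖ = R → ⟪x, gradient w x⟫_ℝ = w x

namespace GraphSolution

variable {E : Type*} [NormedAddCommGroup E] [InnerProductSpace ℝ E] [CompleteSpace E]
  {R p s : ℝ} {g w : E → ℝ}

theorem normSq_pos (h : GraphSolution R p s g w) {x : E} (hx : ‖x‖ ≤ R) :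
    0 < ‖gradient w x‖ ^ 2 + (w x - ⟪x, gradient w x⟫_ℝ) ^ 2 := by
  by_cases h0 : gradient w x = 0
  · have := h.pos x hx
    simp only [h0, inner_zero_right, sub_zero]
    positivity
  · have : 0 < ‖gradient w x‖ := norm_pos_iff.2 h0
    positivity

/-- The logarithmic derivative of the equation. -/
theorem sum_third_deriv [FiniteDimensional ℝ E] (h : GraphSolution R p s g w) (hR : 0 < R)
    {g' : E → E} (hg : ∀ x, HasGradientAt g (g' x) x) (hgpos : ∀ x, ‖x‖ ≤ R → 0 < g x)
    {x : E} (hx : ‖x‖ ≤ R) {ι : Type*} [Fintype ι] (b : OrthonormalBasis ι ℝ E) {d : ι → ℝ}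
    (hd : ∀ i, fderiv ℝ (gradient w) x (b i) = d i • b i) (hd0 : ∀ i, 0 < d i) (Y : E) :
    ∑ i, (d i)⁻¹ * ⟪b i, fderiv ℝ (fderiv ℝ (gradient w)) x Y (b i)⟫_ℝ =
      ⟪g' x, Y⟫_ℝ / g x + (p - 1) * (⟪gradient w x, Y⟫_ℝ / w x) +
      s * (2 * (⟪gradient w x, fderiv ℝ (gradient w) x Y⟫_ℝ
        - (w x - ⟪x, gradient w x⟫_ℝ) * ⟪x, fderiv ℝ (gradient w) x Y⟫_ℝ)
        / (‖gradient w x‖ ^ 2 + (w x - ⟪x, gradient w x⟫_ℝ) ^ 2)) := by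
  classical
  have hN := h.normSq_pos hx
  have hw := h.pos x hx
  have hgx := hgpos x hx
  have hG := hasFDerivAt_gradient h.smooth x
  have hdw := (hasGradientAt_gradient h.smooth x).hasFDerivAt
  have hdN : DifferentiableAt ℝ
      (fun z => ‖gradient w z‖ ^ 2 + (w z - ⟪z, gradient w z⟫_ℝ) ^ 2) x :=
    (hG.differentiableAt.norm_sq ℝ).add
      ((hdw.differentiableAt.sub (differentiableAt_id.inner ℝ hG.differentiableAt)).pow 2)
  have h1 := fderiv_eq_of_eq_on_closedBall hR
    (differentiableAt_det (hasFDerivAt_hessian h.smooth x).differentiableAt)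
    (((hg x).hasFDerivAt.differentiableAt.mul
      (hdw.differentiableAt.rpow_const (p := p - 1) (Or.inl hw.ne'))).mul
      (hdN.rpow_const (p := s) (Or.inl hN.ne'))) h.equation hx
  have h2 := (differentiableAt_det (hasFDerivAt_hessian h.smooth
    x).differentiableAt).hasFDerivAt.hasDerivAt_line Y
  have h3 := h2.unique (hasDerivAt_det_line (hasFDerivAt_hessian h.smooth x) b hd
    (fun i => (hd0 i).ne') Y)
  have h4 := (((hg x).hasFDerivAt.differentiableAt.mul
      (hdw.differentiableAt.rpow_const (p := p - 1) (Or.inl hw.ne'))).mul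
      (hdN.rpow_const (p := s) (Or.inl hN.ne'))).hasFDerivAt.hasDerivAt_line Y
  have hx0 : x + (0 : ℝ) • Y = x := by simp
  have hgl := (hg x).hasFDerivAt.hasDerivAt_line Y
  have hwl := hdw.hasDerivAt_line Y
  have hGl := hG.hasDerivAt_line Y
  have hxl : HasDerivAt (fun t : ℝ => x + t • Y) Y 0 := (hasFDerivAt_id x).hasDerivAt_line Y
  have hNl := hGl.norm_sq.add ((hwl.sub (hxl.inner ℝ hGl)).pow 2)
  have h5 := (hgl.mul (hwl.rpow_const (p := p - 1) (Or.inl (by rw [hx0]; exact hw.ne')))).mul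
    (hNl.rpow_const (p := s) (Or.inl (by
      simp only [hx0, Pi.add_apply, Pi.pow_apply, Pi.sub_apply]; exact hN.ne')))
  have h6 := h4.unique h5
  rw [← h1, h3] at h6
  simp only [hx0, Pi.add_apply, Pi.pow_apply, Pi.sub_apply, Pi.mul_apply,
    InnerProductSpace.toDual_apply_apply] at h6
  have h7 := h.equation x hx
  rw [det_eq_prod_of_eigenbasis b hd] at h7
  have hprod : 0 < ∏ i, d i := Finset.prod_pos fun i _ => hd0 i
  refine mul_left_cancel₀ hprod.ne' (h6.trans ?_)
  rw [h7, Real.rpow_sub_one hw.ne' (p - 1), Real.rpow_sub_one hN.ne' s,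
    real_inner_comm Y (gradient w x)]
  field_simp
  ring

/-- Differentiate `⟪c, ∇w(c)⟫ = w(c)` along a great circle `c` of the boundary sphere: the two first
order terms `⟪c', ∇w⟫` cancel. -/
theorem inner_hessian_eq_zero (h : GraphSolution R p s g w) (hR : 0 < R) {x Y : E}
    (hx : ‖x‖ = R) (hY : ⟪x, Y⟫_ℝ = 0) : ⟪x, fderiv ℝ (gradient w) x Y⟫_ℝ = 0 := by
  by_cases hY0 : Y = 0
  · simp [hY0]
  have hn : 0 < ‖Y‖ := norm_pos_iff.2 hY0
  set a : E := (R / ‖Y‖) • Y with ha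
  have hna : ‖a‖ = R := by
    rw [ha, norm_smul, Real.norm_of_nonneg (by positivity), div_mul_cancel₀ _ hn.ne']
  have hxa : ⟪x, a⟫_ℝ = 0 := by rw [ha, inner_smul_right, hY, mul_zero]
  let c : ℝ → E := fun t => Real.cos t • x + Real.sin t • a
  have hc0 : c 0 = x := by simp [c]
  have hc : HasDerivAt c a 0 := by
    have h1 := ((Real.hasDerivAt_cos 0).smul_const x).add ((Real.hasDerivAt_sin 0).smul_const a)
    simp only [Real.sin_zero, Real.cos_zero, neg_zero, zero_smul, one_smul, zero_add] at h1
    exact h1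
  have hcn : ∀ t, ‖c t‖ = R := by
    intro t
    have h1 : ‖c t‖ ^ 2 = R ^ 2 := by
      simp only [c]
      rw [norm_add_sq_real, norm_smul, norm_smul, inner_smul_left, inner_smul_right, hxa, hna, hx,
        mul_pow, mul_pow, Real.norm_eq_abs, Real.norm_eq_abs, sq_abs, sq_abs]
      simp only [mul_zero, add_zero]
      rw [← add_mul, Real.cos_sq_add_sin_sq, one_mul]
    exact (pow_left_inj₀ (norm_nonneg _) hR.le two_ne_zero).1 h1
  have hG : HasDerivAt (fun t => gradient w (c t)) (fderiv ℝ (gradient w) x a) 0 := by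
    have h1 := hasFDerivAt_gradient h.smooth (c 0)
    have h2 := h1.comp_hasDerivAt (0 : ℝ) hc
    rwa [hc0] at h2
  have hw : HasDerivAt (fun t => w (c t)) ⟪gradient w x, a⟫_ℝ 0 := by
    have h1 := (hasGradientAt_gradient h.smooth (c 0)).hasFDerivAt
    have h2 := h1.comp_hasDerivAt (0 : ℝ) hc
    rwa [hc0] at h2
  have h1 := hc.inner ℝ hG
  simp only [fun t => h.boundary (c t) (hcn t), hc0] at h1
  have h2 := h1.unique hw
  rw [real_inner_comm a (gradient w x), add_eq_right, ha, map_smul, inner_smul_right] at h2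
  exact (mul_eq_zero.1 h2).resolve_left (by positivity)

end GraphSolution

/-- Up to the factor `2λ`, the right-hand expression is the derivative of `|∇w|² + (w - ⟪x, ∇w⟫)²`
along `Y` when `D²w Y = λY`; it gives the sign of the dual factor. -/
theorem normSq_deriv_nonneg {R φ v y xY X : ℝ} (hR : 0 ≤ R) (hv : 0 ≤ v) (hy : 0 ≤ y)
    (hφ : 0 ≤ φ) (hφR : φ ≤ R ^ 2) (hX : 0 ≤ X) (hXR : X ≤ R ^ 2) (hxY : |xY| ≤ R * y)
    (h : R * (1 + 2 * R ^ 2) * v ≤ y) : 0 ≤ y ^ 2 + xY ^ 2 + xY * (v * (1 - φ + X)) := by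
  have h1 : |1 - φ + X| ≤ 1 + 2 * R ^ 2 := by
    rw [abs_le]
    constructor <;> linarith
  have h2 : |xY * (v * (1 - φ + X))| ≤ R * y * (v * (1 + 2 * R ^ 2)) := by
    rw [abs_mul, abs_mul, abs_of_nonneg hv]
    gcongr
  have h3 : R * y * (v * (1 + 2 * R ^ 2)) ≤ y ^ 2 := by
    have := mul_le_mul_of_nonneg_right h hy
    linarith
  linarith [(abs_le.1 h2).1, sq_nonneg xY]

/-! ### The weighted gradient estimate on the ball. -/

namespace GraphSolution

variable {E : Type*} [NormedAddCommGroup E] [InnerProductSpace ℝ E] [CompleteSpace E]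
  {R p s : ℝ} {g w : E → ℝ}

theorem weightedQuot_pos (h : GraphSolution R p s g w) (hR : 0 < R) {x : E} (hx : ‖x‖ ≤ R) :
    0 < weightedQuot R w x :=
  div_pos (h.pos x hx) (weight_pos hR x)

/-- The first and second order conditions at a maximum of `|shiftedGrad|² / weightedQuot ^ γ`. -/
theorem max_conditions (h : GraphSolution R p s g w) (hR : 0 < R) {γ : ℝ} {x : E} (hx : ‖x‖ ≤ R)
    (hmax : ∀ z, ‖z‖ ≤ R → ‖shiftedGrad R w z‖ ^ 2 / weightedQuot R w z ^ γ ≤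
      ‖shiftedGrad R w x‖ ^ 2 / weightedQuot R w x ^ γ) (a : E) :
    2 * ⟪shiftedGrad R w x, fderiv ℝ (shiftedGrad R w) x a⟫_ℝ =
      γ * ‖shiftedGrad R w x‖ ^ 2 / weightedQuot R w x *
        ⟪(weight R x)⁻¹ • shiftedGrad R w x, a⟫_ℝ ∧
    2 * ‖fderiv ℝ (shiftedGrad R w) x a‖ ^ 2
      + 2 * ⟪shiftedGrad R w x, fderiv ℝ (fderiv ℝ (shiftedGrad R w)) x a a⟫_ℝ
      - γ * ‖shiftedGrad R w x‖ ^ 2 / weightedQuot R w x * ((γ - 1) / weightedQuot R w x *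
        ⟪(weight R x)⁻¹ • shiftedGrad R w x, a⟫_ℝ ^ 2
        + ⟪fderiv ℝ (fun z => (weight R z)⁻¹ • shiftedGrad R w z) x a, a⟫_ℝ) ≤ 0 := by
  have hv := h.weightedQuot_pos hR hx
  have hYs := contDiff_shiftedGrad hR h.smooth
  have hvs := contDiff_weightedQuot hR h.smooth
  have hVs : ContDiff ℝ ∞ fun z => (weight R z)⁻¹ • shiftedGrad R w z :=
    ((contDiff_weight R).inv fun z => (weight_pos hR z).ne').smul hYs
  set m : ℝ := ‖shiftedGrad R w x‖ ^ 2 / weightedQuot R w x ^ γ with hm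
  have hvγ : 0 < weightedQuot R w x ^ γ := Real.rpow_pos_of_pos hv γ
  -- With `m` the maximal value of the quotient, this difference is nonpositive on the ball and zero
  -- at `x`, so it has the same maximum point and no denominator.
  have hF : ContDiffAt ℝ 2 (fun z => ‖shiftedGrad R w z‖ ^ 2 - m * weightedQuot R w z ^ γ) x := by
    refine ContDiffAt.sub ?_ (contDiffAt_const.mul ?_)
    · exact ((hYs.norm_sq ℝ).of_le two_le_infty).contDiffAt
    · exact (hvs.of_le two_le_infty).contDiffAt.rpow_const_of_ne hv.ne'
  have hcomp := fderiv_fderiv_normSq_sub_rpow (m := m) (γ := γ)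
    (fun z => (hYs.differentiable (by simp) z).hasFDerivAt)
    (((hYs.fderiv_right (m := ∞) (by simp)).differentiable (by simp) x).hasFDerivAt)
    (hasGradientAt_weightedQuot hR h.smooth)
    ((hVs.differentiable (by simp) x).hasFDerivAt) hv
    ((hF.fderiv_right (m := 1) (by norm_num)).differentiableAt (by simp))
  have hle : ∀ z ∈ Metric.closedBall (0 : E) R,
      ‖shiftedGrad R w z‖ ^ 2 - m * weightedQuot R w z ^ γ ≤
      ‖shiftedGrad R w x‖ ^ 2 - m * weightedQuot R w x ^ γ := by
    intro z hz
    rw [mem_closedBall_zero_iff] at hz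
    have h1 := hmax z hz
    rw [div_le_iff₀ (Real.rpow_pos_of_pos (h.weightedQuot_pos hR hz) γ)] at h1
    have h2 : ‖shiftedGrad R w x‖ ^ 2 - m * weightedQuot R w x ^ γ = 0 := by
      rw [hm, div_mul_cancel₀ _ hvγ.ne', sub_self]
    rw [h2]
    linarith
  -- At the boundary `φ = R²` makes `Y` tangential; symmetry of the Hessian and the differentiated
  -- boundary condition then remove every term.
  have hbd : ‖x‖ = R → fderiv ℝ
      (fun z => ‖shiftedGrad R w z‖ ^ 2 - m * weightedQuot R w z ^ γ) x x = 0 := by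
    intro hxR
    have hxY : ⟪x, shiftedGrad R w x⟫_ℝ = 0 := by
      rw [shiftedGrad, inner_sub_right, inner_smul_right, real_inner_self_eq_norm_sq,
        h.boundary x hxR, weightedQuot, weight, hxR]
      field_simp
      ring
    have hYx : ⟪shiftedGrad R w x, x⟫_ℝ = 0 := by rw [real_inner_comm, hxY]
    rw [(hcomp x).1, fderiv_shiftedGrad hR h.smooth, inner_sub_right, inner_sub_right,
      inner_smul_right, inner_smul_right, real_inner_smul_left, hYx, real_inner_comm,
      inner_hessian_comm h.smooth, real_inner_comm, h.inner_hessian_eq_zero hR hxR hxY]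
    ring
  obtain ⟨h1, h2⟩ := fderiv_eq_zero_and_second_nonpos hR hx hF hle hbd
  have hr1 : weightedQuot R w x ^ (γ - 1) = weightedQuot R w x ^ γ / weightedQuot R w x :=
    Real.rpow_sub_one hv.ne' γ
  have hr2 : weightedQuot R w x ^ (γ - 2) = weightedQuot R w x ^ γ / weightedQuot R w x ^ 2 := by
    rw [show γ - 2 = γ - 1 - 1 by ring, Real.rpow_sub_one hv.ne', hr1]
    field_simp
  constructor
  · have h3 := (hcomp a).1
    rw [h1, hr1, zero_apply] at h3
    rw [sub_eq_zero.1 h3.symm, hm]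
    field_simp
  · refine le_of_eq_of_le ?_ (h2 a)
    rw [(hcomp a).2, hr1, hr2, hm]
    field_simp

/-- At a maximum of `|shiftedGrad|² / weightedQuot ^ γ` the gradient is controlled. -/
theorem bound_at_max [FiniteDimensional ℝ E] (h : GraphSolution R p s g w) (hR : 0 < R)
    (hp : 1 < p) (hs : 0 ≤ s) {g' : E → E} (hg : ∀ x, HasGradientAt g (g' x) x)
    (hgpos : ∀ x, ‖x‖ ≤ R → 0 < g x) {Cg : ℝ} (hCg : 0 ≤ Cg)
    (hgC : ∀ x, ‖x‖ ≤ R → ‖g' x‖ ≤ Cg * g x) {γ : ℝ} {x : E} (hx : ‖x‖ ≤ R)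
    (hmax : ∀ z, ‖z‖ ≤ R → ‖shiftedGrad R w z‖ ^ 2 / weightedQuot R w z ^ γ ≤
      ‖shiftedGrad R w x‖ ^ 2 / weightedQuot R w x ^ γ)
    (h1 : R * (1 + 2 * R ^ 2) * weightedQuot R w x ≤ ‖shiftedGrad R w x‖)
    (h2 : 2 * R * weightedQuot R w x ≤ γ * ‖shiftedGrad R w x‖)
    (h3 : 4 * R ^ 2 * weightedQuot R w x ^ 2 ≤ (γ - γ ^ 2 / 2) * ‖shiftedGrad R w x‖ ^ 2) :
    (2 * (p - 1) - Module.finrank ℝ E * γ) * ‖shiftedGrad R w x‖ ≤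
      (2 * Cg * R ^ 2 + (2 * (p - 1) + 2 * Module.finrank ℝ E + 4) * R) * weightedQuot R w x := by
  have hv := h.weightedQuot_pos hR hx
  have hφ := weight_pos hR x
  have hcond := h.max_conditions hR hx hmax
  have hYx := fderiv_shiftedGrad hR h.smooth x
  have hYxx := fderiv_fderiv_shiftedGrad hR h.smooth x
  have hvaa := weight_mul_inner_fderiv hR h.smooth x
  have hwv : w x = weight R x * weightedQuot R w x := by
    rw [weightedQuot, mul_div_cancel₀ _ hφ.ne']
  have hGY : gradient w x = shiftedGrad R w x + weightedQuot R w x • x := by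
    rw [shiftedGrad, sub_add_cancel]
  set v := weightedQuot R w x with hvdef
  set φ := weight R x with hφdef
  set Y := shiftedGrad R w x with hYdef
  set y := ‖Y‖ with hydef
  have hy : 0 < y := lt_of_lt_of_le (by positivity) h1
  set A := fderiv ℝ (gradient w) x with hA
  set xY := ⟪x, Y⟫_ℝ with hxYdef
  have hφle : φ ≤ R ^ 2 := by
    have := pow_le_pow_left₀ (norm_nonneg x) hx 2
    rw [hφdef, weight]
    linarith
  have hxYle : |xY| ≤ R * y :=
    (abs_real_inner_le_norm x Y).trans (mul_le_mul_of_nonneg_right hx (norm_nonneg Y))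
  set lam : ℝ := (xY + v * φ + γ * y ^ 2 / (2 * v)) / φ with hlamdef
  have hlam : φ * lam = xY + v * φ + γ * y ^ 2 / (2 * v) := by
    rw [hlamdef, mul_div_cancel₀ _ hφ.ne']
  -- The assumption `h2` lets the quadratic term `γy²/(2v)` absorb `|⟪x, Y⟫| ≤ R y`.
  have hσ : v ≤ lam := by
    have h4 : 0 ≤ xY + γ * y ^ 2 / (2 * v) := by
      have h5 : R * y ≤ γ * y ^ 2 / (2 * v) := by
        rw [le_div_iff₀ (by positivity)]
        nlinarith
      linarith [(abs_le.1 hxYle).1]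
    rw [hlamdef, le_div_iff₀ hφ]
    linarith
  have hlam0 : 0 < lam := hv.trans_le hσ
  have hsymm : (A : E →ₗ[ℝ] E).IsSymmetric := fun a b => by
    simpa [real_inner_comm] using inner_hessian_comm h.smooth x a b
  set b := hsymm.eigenvectorBasis rfl with hb
  set d := hsymm.eigenvalues rfl with hd
  have hAb : ∀ i, A (b i) = d i • b i := fun i =>
    hsymm.apply_eigenvectorBasis rfl i
  have hd0 : ∀ i, 0 < d i := fun i => by
    have h4 := h.posDef x hx (b i) (b.orthonormal.ne_zero i)
    rwa [← hA, hAb, real_inner_smul_left, real_inner_self_eq_norm_sq, b.orthonormal.1 i, one_pow,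
      mul_one] at h4
  -- the derivative of `shiftedGrad` in an eigendirection, against `shiftedGrad`
  have hYY : ∀ i, ⟪Y, fderiv ℝ (shiftedGrad R w) x (b i)⟫_ℝ =
      (φ * d i - xY - v * φ) * (⟪Y, b i⟫_ℝ / φ) := by
    intro i
    rw [hYx, hAb, inner_sub_right, inner_sub_right, inner_smul_right, inner_smul_right,
      inner_smul_right, real_inner_smul_left, real_inner_comm x Y, ← hxYdef]
    field_simp
  have hfirst : ∀ i, (φ * d i - xY - v * φ) * (⟪Y, b i⟫_ℝ / φ) =
      γ * y ^ 2 / (2 * v) * (⟪Y, b i⟫_ℝ / φ) := by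
    intro i
    have h4 := (hcond (b i)).1
    rw [hYY, real_inner_smul_left] at h4
    field_simp at h4 ⊢
    linarith
  have hdir : ∀ i, 2 * ((d i)⁻¹ * ⟪b i, fderiv ℝ (fderiv ℝ (gradient w)) x Y (b i)⟫_ℝ)
      + ((γ - γ ^ 2 / 2) * y ^ 2 / v ^ 2 - 4 * φ) * ((⟪Y, b i⟫_ℝ / φ) ^ 2 / lam) - 2 * (lam - v)
      + 4 * (lam - v) * (⟪x, b i⟫_ℝ * (⟪Y, b i⟫_ℝ / φ) / lam) ≤ 0 := by
    intro i
    have hvi : ⟪fderiv ℝ (fun z => (weight R z)⁻¹ • shiftedGrad R w z) x (b i), b i⟫_ℝ =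
        (d i - 2 * (⟪Y, b i⟫_ℝ / φ) * ⟪x, b i⟫_ℝ - v) / φ := by
      rw [eq_div_iff hφ.ne', mul_comm, hvaa, hAb, real_inner_smul_left, real_inner_smul_left,
        real_inner_self_eq_norm_sq, b.orthonormal.1 i]
      ring
    have h4 := (hcond (b i)).2
    rw [hYxx, hvi, inner_sub_right, inner_sub_right, inner_smul_right, inner_smul_right,
      real_inner_comm x Y, ← hxYdef, real_inner_smul_left, inner_third_deriv_comm h.smooth] at h4
    rw [← div_eq_inv_mul]
    refine eigendirection_inequality (d2 := ‖fderiv ℝ (shiftedGrad R w) x (b i)‖ ^ 2)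
      hφ hv (pow_pos hy 2) (hd0 i) hlam hσ (hfirst i) ?_ ?_
    · have h5 := abs_real_inner_le_norm Y (fderiv ℝ (shiftedGrad R w) x (b i))
      have h6 := pow_le_pow_left₀ (abs_nonneg _) h5 2
      rw [sq_abs, hYY, hfirst, mul_pow] at h6
      refine le_of_eq_of_le ?_ (h6.trans_eq (by rw [mul_pow, mul_comm]))
      ring
    · refine le_of_eq_of_le ?_ h4
      field_simp
  have hsum := Finset.sum_nonpos fun i (_ : i ∈ Finset.univ) => hdir i
  simp only [Finset.sum_add_distrib, Finset.sum_sub_distrib, ← Finset.mul_sum, Finset.sum_const,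
    Finset.card_univ, Fintype.card_fin, nsmul_eq_mul, ← Finset.sum_div] at hsum
  have hsumY : ∑ i, (⟪Y, b i⟫_ℝ / φ) ^ 2 = y ^ 2 / φ ^ 2 := by
    simp only [div_pow, ← Finset.sum_div]
    congr 1
    simpa [Real.norm_eq_abs, sq_abs] using b.sum_sq_norm_inner_left Y
  have hsumx : ∑ i, ⟪x, b i⟫_ℝ * (⟪Y, b i⟫_ℝ / φ) = xY / φ := by
    simp only [← mul_div_assoc, ← Finset.sum_div]
    congr 1
    rw [hxYdef, ← b.sum_inner_mul_inner x Y]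
    exact Finset.sum_congr rfl fun i _ => by rw [real_inner_comm Y (b i)]
  rw [hsumY, hsumx] at hsum
  -- By the first order condition, every eigenvector not orthogonal to `Y` has eigenvalue `lam`.
  have hAY : A Y = lam • Y := by
    have h4 : ∀ i, ⟪b i, A Y⟫_ℝ = ⟪b i, lam • Y⟫_ℝ := by
      intro i
      rw [real_inner_comm, inner_hessian_comm h.smooth, ← hA, hAb, real_inner_smul_left,
        inner_smul_right, real_inner_comm]
      by_cases hz : ⟪Y, b i⟫_ℝ = 0
      · rw [hz, mul_zero, mul_zero]
      · have h5 := mul_right_cancel₀ (div_ne_zero hz hφ.ne') (hfirst i)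
        have h6 : φ * d i = φ * lam := by linarith
        rw [mul_left_cancel₀ hφ.ne' h6]
    rw [← b.sum_repr' (A Y), ← b.sum_repr' (lam • Y)]
    exact Finset.sum_congr rfl fun i _ => by rw [h4]
  have hT := h.sum_third_deriv hR hg hgpos hx b hAb hd0 Y
  rw [hT, ← mul_sub, mul_left_comm (2 : ℝ) (Module.finrank ℝ E : ℝ)] at hsum
  refine bound_of_summed_inequality hφ hv hy (Nat.cast_nonneg _) hp hφle hσ hlam
    (by positivity) hCg ?_ ?_ hxYle ?_ hsum (gY := ⟪g' x, Y⟫_ℝ / g x)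
    (S := y ^ 2 / φ ^ 2)
  · refine le_trans ?_ h3
    gcongr
  · rw [abs_div, abs_of_pos (hgpos x hx), div_le_iff₀ (hgpos x hx)]
    refine (abs_real_inner_le_norm _ _).trans ?_
    have := mul_le_mul_of_nonneg_right (hgC x hx) (norm_nonneg Y)
    linarith
  · have hGY' : ⟪gradient w x, Y⟫_ℝ = y ^ 2 + v * xY := by
      rw [hGY, inner_add_left, real_inner_smul_left, real_inner_self_eq_norm_sq]
    rw [hGY', hwv, ← hA, hAY]
    -- The contribution of the dual factor is discarded; `s ≥ 0`, that is `q ≤ n + 1`, is needed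
    -- here.
    refine le_add_of_nonneg_right (mul_nonneg hs (div_nonneg ?_ (by positivity)))
    rw [inner_smul_right, inner_smul_right, hGY', hGY, inner_add_right, inner_smul_right,
      ← hxYdef, real_inner_self_eq_norm_sq]
    have h4 : 0 ≤ y ^ 2 + xY ^ 2 + xY * (v * (1 - φ + ‖x‖ ^ 2)) :=
      normSq_deriv_nonneg hR.le hv.le hy.le hφ.le hφle (sq_nonneg _)
        (pow_le_pow_left₀ (norm_nonneg x) hx 2) hxYle h1
    have h8 : 2 * (lam * (y ^ 2 + v * xY) - (φ * v - (xY + v * ‖x‖ ^ 2)) * (lam * xY)) =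
        2 * lam * (y ^ 2 + xY ^ 2 + xY * (v * (1 - φ + ‖x‖ ^ 2))) := by ring
    rw [h8]
    positivity

/-- Substitute `∇w = Y + v x` and `w = φv`; then `w - ⟪x, ∇w⟫ = v(R² - |x|²)/2 - ⟪x, Y⟫`. -/
theorem normSq_le (hR : 0 < R) (w : E → ℝ) {x : E} (hx : ‖x‖ ≤ R) :
    ‖gradient w x‖ ^ 2 + (w x - ⟪x, gradient w x⟫_ℝ) ^ 2 ≤
      (2 + 2 * R ^ 2 + 2 * R ^ 4) * (‖shiftedGrad R w x‖ ^ 2 + weightedQuot R w x ^ 2) := by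
  have hwv : w x = weight R x * weightedQuot R w x := by
    rw [weightedQuot, mul_div_cancel₀ _ (weight_pos hR x).ne']
  have hGY : gradient w x = shiftedGrad R w x + weightedQuot R w x • x := by
    rw [shiftedGrad, sub_add_cancel]
  have hx2 : ‖x‖ ^ 2 ≤ R ^ 2 := pow_le_pow_left₀ (norm_nonneg x) hx 2
  set v := weightedQuot R w x
  set Y := shiftedGrad R w x
  have hxY : ⟪x, Y⟫_ℝ ^ 2 ≤ R ^ 2 * ‖Y‖ ^ 2 := by
    have h1 := pow_le_pow_left₀ (abs_nonneg _) ((abs_real_inner_le_norm x Y).trans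
      (mul_le_mul_of_nonneg_right hx (norm_nonneg Y))) 2
    rwa [sq_abs, mul_pow] at h1
  have h1 : ‖gradient w x‖ ^ 2 ≤ 2 * ‖Y‖ ^ 2 + 2 * (v ^ 2 * R ^ 2) := by
    have h2 : ‖v • x‖ ^ 2 ≤ v ^ 2 * R ^ 2 := by
      rw [norm_smul, mul_pow, Real.norm_eq_abs, sq_abs]
      gcongr
    rw [hGY]
    have h3 := pow_le_pow_left₀ (norm_nonneg _) (norm_add_le Y (v • x)) 2
    linarith [sq_nonneg (‖Y‖ - ‖v • x‖)]
  have h2 : w x - ⟪x, gradient w x⟫_ℝ = v * ((R ^ 2 - ‖x‖ ^ 2) / 2) - ⟪x, Y⟫_ℝ := by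
    rw [hwv, hGY, inner_add_right, inner_smul_right, real_inner_self_eq_norm_sq, weight]
    ring
  have h3 : (v * ((R ^ 2 - ‖x‖ ^ 2) / 2)) ^ 2 ≤ v ^ 2 * R ^ 4 := by
    have h4 : ((R ^ 2 - ‖x‖ ^ 2) / 2) ^ 2 ≤ (R ^ 2) ^ 2 :=
      pow_le_pow_left₀ (by linarith) (by linarith [sq_nonneg ‖x‖, sq_nonneg R]) 2
    rw [mul_pow, show R ^ 4 = (R ^ 2) ^ 2 by ring]
    gcongr
  rw [h2]
  have h5 : 0 ≤ R ^ 4 * ‖Y‖ ^ 2 := by positivity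
  linarith [sq_nonneg (v * ((R ^ 2 - ‖x‖ ^ 2) / 2) + ⟪x, Y⟫_ℝ), sq_nonneg v, sq_nonneg ‖Y‖]

variable [FiniteDimensional ℝ E]

theorem exists_log_gradient_bound {g : E → ℝ} (hg : ContDiff ℝ ∞ g) (R : ℝ)
    (hgpos : ∀ x, ‖x‖ ≤ R → 0 < g x) :
    ∃ C, 0 ≤ C ∧ ∀ x, ‖x‖ ≤ R → ‖gradient g x‖ ≤ C * g x := by
  have hc : ContinuousOn (fun x => ‖gradient g x‖ / g x) (Metric.closedBall 0 R) :=
    (contDiff_gradient hg).continuous.norm.continuousOn.div hg.continuous.continuousOn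
      fun x hx => (hgpos x (by simpa using hx)).ne'
  obtain ⟨C, hC⟩ := (isCompact_closedBall (0 : E) R).exists_bound_of_continuousOn hc
  refine ⟨max C 0, le_max_right _ _, fun x hx => ?_⟩
  have h1 := (le_abs_self _).trans (hC x (by simpa using hx))
  rw [div_le_iff₀ (hgpos x hx)] at h1
  exact h1.trans (mul_le_mul_of_nonneg_right (le_max_left _ _) (hgpos x hx).le)

/-- At a maximum of `|shiftedGrad|² / weightedQuot ^ γ`, with a constant independent of the
solution. -/
theorem exists_bound_at_max (hR : 0 < R) (hp : 1 < p) (hs : 0 ≤ s) (hg : ContDiff ℝ ∞ g)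
    (hgpos : ∀ x, ‖x‖ ≤ R → 0 < g x) {γ : ℝ} (hγ : 0 < γ) (hγ2 : γ < 2)
    (hγp : Module.finrank ℝ E * γ < 2 * (p - 1)) :
    ∃ K, 0 ≤ K ∧ ∀ w, GraphSolution R p s g w → ∀ x, ‖x‖ ≤ R →
      (∀ z, ‖z‖ ≤ R → ‖shiftedGrad R w z‖ ^ 2 / weightedQuot R w z ^ γ ≤
        ‖shiftedGrad R w x‖ ^ 2 / weightedQuot R w x ^ γ) →
      ‖shiftedGrad R w x‖ ≤ K * weightedQuot R w x := by
  obtain ⟨Cg, hCg, hgC⟩ := exists_log_gradient_bound hg R hgpos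
  have hκ : 0 < γ - γ ^ 2 / 2 := by nlinarith
  have hδ : 0 < 2 * (p - 1) - Module.finrank ℝ E * γ := by linarith
  set c₁ := R * (1 + 2 * R ^ 2)
  set c₂ := 2 * R / γ with hc₂
  set c₃ := 4 * R ^ 2 / (γ - γ ^ 2 / 2) with hc₃
  set c₄ := (2 * Cg * R ^ 2 + (2 * (p - 1) + 2 * Module.finrank ℝ E + 4) * R) /
    (2 * (p - 1) - Module.finrank ℝ E * γ) with hc₄
  have hc₁0 : 0 ≤ c₁ := by positivity
  have hc₂0 : 0 ≤ c₂ := by positivity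
  have hc₃0 : 0 ≤ c₃ := by positivity
  have hc₄0 : 0 ≤ c₄ := by
    have : 0 < p - 1 := by linarith
    positivity
  -- `c₁` gives the sign of the dual factor, `c₂` gives `v ≤ lam`, `c₃` the sign of the quadratic
  -- term, and `c₄` is the resulting bound. The `+ 1` serves `c₃ ≤ (c₃ + 1)²`, as that condition is
  -- on squares. If the sum failed as a bound, all three conditions would hold and `c₄` would give a
  -- contradiction.
  refine ⟨c₁ + c₂ + (c₃ + 1) + c₄, by positivity, fun w h x hx hmax => ?_⟩
  have hv := h.weightedQuot_pos hR hx
  set v := weightedQuot R w x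
  by_contra! hcon
  have hle : ∀ c, c ≤ c₁ + c₂ + (c₃ + 1) + c₄ → c * v ≤ ‖shiftedGrad R w x‖ := fun c hc =>
    (mul_le_mul_of_nonneg_right hc hv.le).trans hcon.le
  have h1 := hle c₁ (by linarith)
  have h2 : 2 * R * v ≤ γ * ‖shiftedGrad R w x‖ := by
    have h3 := mul_le_mul_of_nonneg_left (hle c₂ (by linarith)) hγ.le
    refine le_of_eq_of_le ?_ h3
    rw [hc₂]
    field_simp
  have h3 : 4 * R ^ 2 * v ^ 2 ≤ (γ - γ ^ 2 / 2) * ‖shiftedGrad R w x‖ ^ 2 := by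
    have h4 := pow_le_pow_left₀ (by positivity) (hle (c₃ + 1) (by linarith)) 2
    have h5 : c₃ * v ^ 2 ≤ ‖shiftedGrad R w x‖ ^ 2 := by
      refine le_trans ?_ h4
      rw [mul_pow]
      gcongr
      nlinarith
    have h6 := mul_le_mul_of_nonneg_left h5 hκ.le
    refine le_of_eq_of_le ?_ h6
    rw [hc₃, ← mul_assoc, mul_div_cancel₀ _ hκ.ne']
  have h4 := h.bound_at_max hR hp hs
    (fun x => ((hg.differentiable (by simp)) x).hasGradientAt) hgpos hCg hgC hx hmax h1 h2 h3
  have h5 : ‖shiftedGrad R w x‖ ≤ c₄ * v := by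
    rw [hc₄, div_mul_eq_mul_div, le_div_iff₀ hδ, mul_comm]
    exact h4
  have h6 : c₄ * v ≤ (c₁ + c₂ + (c₃ + 1) + c₄) * v :=
    mul_le_mul_of_nonneg_right (by linarith) hv.le
  linarith

/-- The weighted gradient estimate for the Monge–Ampère equation on a ball. -/
theorem exists_gradient_bound (hR : 0 < R) (hp : 1 < p) (hs : 0 ≤ s) (hg : ContDiff ℝ ∞ g)
    (hgpos : ∀ x, ‖x‖ ≤ R → 0 < g x) {γ : ℝ} (hγ : 0 < γ) (hγ2 : γ < 2)
    (hγp : Module.finrank ℝ E * γ < 2 * (p - 1)) :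
    ∃ C, 0 < C ∧ ∀ w, GraphSolution R p s g w → ∀ M, (∀ z, ‖z‖ ≤ R → w z ≤ M) →
      ∀ x, ‖x‖ ≤ R → ‖gradient w x‖ ^ 2 + (w x - ⟪x, gradient w x⟫_ℝ) ^ 2 ≤
        C * M ^ (2 - γ) * w x ^ γ := by
  obtain ⟨K, hK, hmaxK⟩ := exists_bound_at_max hR hp hs hg hgpos hγ hγ2 hγp
  set c : ℝ := 2 / R ^ 2 with hc
  have hc0 : 0 < c := by positivity
  refine ⟨(2 + 2 * R ^ 2 + 2 * R ^ 4) * ((K ^ 2 + 1) * c ^ 2), by positivity,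
    fun w h M hM x hx => ?_⟩
  have hvpos : ∀ z, ‖z‖ ≤ R → 0 < weightedQuot R w z := fun z hz => h.weightedQuot_pos hR hz
  have hvw : ∀ z, ‖z‖ ≤ R → weightedQuot R w z ≤ c * w z := by
    intro z hz
    have hwz := h.pos z hz
    rw [weightedQuot, hc, div_le_iff₀ (weight_pos hR z), weight]
    have h1 : 2 / R ^ 2 * w z * ((R ^ 2 + ‖z‖ ^ 2) / 2) = w z + w z * ‖z‖ ^ 2 / R ^ 2 := by
      field_simp
    rw [h1]
    exact le_add_of_nonneg_right (by positivity)
  -- One factor is absorbed by the maximum `M`, the other is the weight of the estimate.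
  have hsplit : ∀ t : ℝ, 0 < t → t ^ 2 = t ^ (2 - γ) * t ^ γ := fun t ht => by
    rw [← Real.rpow_add ht, sub_add_cancel, Real.rpow_two]
  have hMpos : 0 < M := (h.pos x hx).trans_le (hM x hx)
  have hvM : ∀ z, ‖z‖ ≤ R → weightedQuot R w z ^ (2 - γ) ≤ (c * M) ^ (2 - γ) := fun z hz =>
    Real.rpow_le_rpow (hvpos z hz).le
      ((hvw z hz).trans (mul_le_mul_of_nonneg_left (hM z hz) hc0.le)) (by linarith)
  have hvγ : weightedQuot R w x ^ γ ≤ (c * w x) ^ γ :=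
    Real.rpow_le_rpow (hvpos x hx).le (hvw x hx) hγ.le
  have hprod : (c * M) ^ (2 - γ) * (c * w x) ^ γ = c ^ 2 * (M ^ (2 - γ) * w x ^ γ) := by
    rw [Real.mul_rpow hc0.le hMpos.le, Real.mul_rpow hc0.le (h.pos x hx).le, hsplit c hc0]
    ring
  have hcont : ContinuousOn (fun z => ‖shiftedGrad R w z‖ ^ 2 / weightedQuot R w z ^ γ)
      (Metric.closedBall 0 R) := by
    refine ((contDiff_shiftedGrad hR h.smooth).continuous.norm.pow 2).continuousOn.div
      ((contDiff_weightedQuot hR h.smooth).continuous.rpow_const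
        fun z => Or.inr hγ.le).continuousOn fun z hz => ?_
    exact (Real.rpow_pos_of_pos (hvpos z (by simpa using hz)) γ).ne'
  obtain ⟨x₀, hx₀, hmax⟩ := (isCompact_closedBall (0 : E) R).exists_isMaxOn
    ⟨0, Metric.mem_closedBall_self hR.le⟩ hcont
  rw [mem_closedBall_zero_iff] at hx₀
  have hmax' : ∀ z, ‖z‖ ≤ R → ‖shiftedGrad R w z‖ ^ 2 / weightedQuot R w z ^ γ ≤
      ‖shiftedGrad R w x₀‖ ^ 2 / weightedQuot R w x₀ ^ γ := fun z hz => hmax (by simpa using hz)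
  have hm : ‖shiftedGrad R w x₀‖ ^ 2 / weightedQuot R w x₀ ^ γ ≤ K ^ 2 * (c * M) ^ (2 - γ) := by
    rw [div_le_iff₀ (Real.rpow_pos_of_pos (hvpos x₀ hx₀) γ)]
    have h1 := pow_le_pow_left₀ (norm_nonneg _) (hmaxK w h x₀ hx₀ hmax') 2
    rw [mul_pow, hsplit _ (hvpos x₀ hx₀)] at h1
    refine h1.trans ?_
    rw [← mul_assoc]
    have := hvM x₀ hx₀
    have := (Real.rpow_pos_of_pos (hvpos x₀ hx₀) γ).le
    gcongr
  have hcM : 0 ≤ (c * M) ^ (2 - γ) := by positivity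
  have hvγ0 : 0 ≤ weightedQuot R w x ^ γ := (Real.rpow_pos_of_pos (hvpos x hx) γ).le
  have hY : ‖shiftedGrad R w x‖ ^ 2 ≤ K ^ 2 * (c ^ 2 * (M ^ (2 - γ) * w x ^ γ)) := by
    have h1 := (hmax' x hx).trans hm
    rw [div_le_iff₀ (Real.rpow_pos_of_pos (hvpos x hx) γ)] at h1
    rw [← hprod, ← mul_assoc]
    refine h1.trans ?_
    gcongr
  have hv2 : weightedQuot R w x ^ 2 ≤ c ^ 2 * (M ^ (2 - γ) * w x ^ γ) := by
    rw [hsplit _ (hvpos x hx), ← hprod]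
    exact mul_le_mul (hvM x hx) hvγ hvγ0 hcM
  refine (normSq_le hR w hx).trans ?_
  rw [mul_assoc, mul_assoc]
  refine mul_le_mul_of_nonneg_left ?_ (by positivity)
  linarith

end GraphSolution

/-! ### The support vector field on the cap. -/

theorem coe_orthogonalProjectionOnto_singleton {E : Type*} [NormedAddCommGroup E]
    [InnerProductSpace ℝ E] {ν : E} (hν : ‖ν‖ = 1) (y : E) :
    (((Submodule.span ℝ {ν})ᗮ.orthogonalProjectionOnto y : (Submodule.span ℝ {ν})ᗮ) : E) =
      y - ⟪ν, y⟫_ℝ • ν := by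
  rw [Submodule.orthogonalProjectionOnto_orthogonal]
  exact congrArg (fun z => y - z) (Submodule.starProjection_unit_singleton ℝ hν y)

/-- The support vector field `h ν + ∇h`, extended to the ambient space. -/
def supportField {n : ℕ} (θ : ℝ) (K : Amb n → ℝ) (z : Amb n) : Amb n :=
  K z • nu θ z + tanGrad θ K z

theorem inner_nu_tanGrad {n : ℕ} {θ : ℝ} (K : Amb n → ℝ) (z : Amb n) :
    ⟪nu θ z, tanGrad θ K z⟫_ℝ = ⟪nu θ z, gradient K z⟫_ℝ * (1 - ‖nu θ z‖ ^ 2) := by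
  rw [tanGrad, inner_sub_right, inner_smul_right, real_inner_self_eq_norm_sq]
  ring

theorem inner_tanGrad {n : ℕ} {θ : ℝ} (K : Amb n → ℝ) {z t : Amb n} (ht : t ∈ tangent θ z) :
    ⟪tanGrad θ K z, t⟫_ℝ = ⟪gradient K z, t⟫_ℝ := by
  rw [tanGrad, inner_sub_left, real_inner_smul_left, mem_tangent.1 ht, mul_zero, sub_zero]

theorem norm_supportField_sq {n : ℕ} {θ : ℝ} (K : Amb n → ℝ) {z : Amb n} (hz : ‖nu θ z‖ = 1) :
    ‖supportField θ K z‖ ^ 2 = K z ^ 2 + ‖tanGrad θ K z‖ ^ 2 := by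
  have h1 : ⟪nu θ z, tanGrad θ K z⟫_ℝ = 0 := by rw [inner_nu_tanGrad, hz]; ring
  rw [supportField, norm_add_sq_real, real_inner_smul_left, h1, norm_smul, hz, mul_one,
    Real.norm_eq_abs, sq_abs]
  ring

theorem inner_nu_supportField {n : ℕ} {θ : ℝ} (K : Amb n → ℝ) {z : Amb n} (hz : ‖nu θ z‖ = 1) :
    ⟪nu θ z, supportField θ K z⟫_ℝ = K z := by
  have h1 : ⟪nu θ z, tanGrad θ K z⟫_ℝ = 0 := by rw [inner_nu_tanGrad, hz]; ring
  rw [supportField, inner_add_right, inner_smul_right, h1, real_inner_self_eq_norm_sq, hz]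
  ring

theorem hasFDerivAt_nu {n : ℕ} (θ : ℝ) (z : Amb n) :
    HasFDerivAt (nu (n := n) θ) (ContinuousLinearMap.id ℝ (Amb n)) z :=
  (hasFDerivAt_id z).sub_const _

theorem differentiable_supportField {n : ℕ} {θ : ℝ} {K : Amb n → ℝ} (hK : ContDiff ℝ ∞ K) :
    Differentiable ℝ (supportField θ K) :=
  ((hK.differentiable (by simp)).smul fun z => (hasFDerivAt_nu θ z).differentiableAt).add
    (differentiable_tanGrad hK)

/-- The support vector field has derivative `∇²h + h I` along the unit sphere. -/
theorem fderiv_supportField {n : ℕ} {θ : ℝ} {K : Amb n → ℝ} (hK : ContDiff ℝ ∞ K) {z : Amb n}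
    (hz : ‖nu θ z‖ = 1) (t : tangent θ z) :
    fderiv ℝ (supportField θ K) z t =
      ((tanHess θ K z + K z • LinearMap.id : tangent θ z →ₗ[ℝ] tangent θ z) t : Amb n) := by
  have hKd := (hasGradientAt_gradient hK z).hasFDerivAt.hasDerivAt_line (t : Amb n)
  have hnl := (hasFDerivAt_nu θ z).hasDerivAt_line (t : Amb n)
  have hgl := (hasFDerivAt_gradient hK z).hasDerivAt_line (t : Amb n)
  have htl := (differentiable_tanGrad (θ := θ) hK z).hasFDerivAt.hasDerivAt_line (t : Amb n)
  have hz0 : z + (0 : ℝ) • (t : Amb n) = z := by simp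
  have hνt : ⟪nu θ z, (t : Amb n)⟫_ℝ = 0 := mem_tangent.1 t.2
  have h1 : fderiv ℝ (supportField θ K) z t = ⟪gradient K z, (t : Amb n)⟫_ℝ • nu θ z
      + K z • (t : Amb n) + fderiv ℝ (tanGrad θ K) z t := by
    have h2 := (differentiable_supportField (θ := θ) hK z).hasFDerivAt.hasDerivAt_line (t : Amb n)
    have h3 := (hKd.smul hnl).add htl
    rw [h2.unique h3, hz0]
    simp only [ContinuousLinearMap.id_apply, InnerProductSpace.toDual_apply_apply]
    abel
  -- `inner_nu_tanGrad` holds off the sphere too, and its factor `1 - ‖ν‖²` vanishes to first order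
  -- along `t`. The normal part found here cancels the term `⟪∇K, t⟫ν` coming from `K ν`.
  have h4 : ⟪nu θ z, fderiv ℝ (tanGrad θ K) z t⟫_ℝ = -⟪gradient K z, (t : Amb n)⟫_ℝ := by
    have h5 := hnl.inner ℝ htl
    have h6 := (hnl.inner ℝ hgl).mul (hnl.norm_sq.const_sub 1)
    simp only [inner_nu_tanGrad] at h5
    have h7 := h5.unique h6
    simp only [hz0, ContinuousLinearMap.id_apply, hz, hνt] at h7
    rw [real_inner_comm (tanGrad θ K z), inner_tanGrad K t.2] at h7
    linarith
  rw [h1, LinearMap.add_apply, Submodule.coe_add]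
  have h8 : ((tanHess θ K z t : tangent θ z) : Amb n) = fderiv ℝ (tanGrad θ K) z t
      + ⟪gradient K z, (t : Amb n)⟫_ℝ • nu θ z := by
    have h9 := coe_orthogonalProjectionOnto_singleton hz (fderiv ℝ (tanGrad θ K) z t)
    rw [h4, neg_smul, sub_neg_eq_add] at h9
    exact h9
  rw [h8]
  simp
  abel

/-! ### The central projection. -/

/-- The horizontal hyperplane, the parameter space of the central projection. -/
abbrev Horiz (n : ℕ) : Submodule ℝ (Amb n) := (Submodule.span ℝ {eLast n})ᗮ

theorem norm_eLast (n : ℕ) : ‖eLast n‖ = 1 := by simp [eLast]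

theorem inner_eLast_coe {n : ℕ} (x : Horiz n) : ⟪eLast n, (x : Amb n)⟫_ℝ = 0 :=
  Submodule.mem_orthogonal_singleton_iff_inner_right.1 x.2

theorem finrank_horiz (n : ℕ) : Module.finrank ℝ (Horiz n) = n := by
  have : Fact (Module.finrank ℝ (Amb n) = n + 1) := ⟨by simp⟩
  exact Submodule.finrank_orthogonal_span_singleton (norm_ne_zero_iff.1 (by simp [norm_eLast]))

theorem finrank_tangent {n : ℕ} {θ : ℝ} {z : Amb n} (hz : ‖nu θ z‖ = 1) :
    Module.finrank ℝ (tangent θ z) = n := by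
  have : Fact (Module.finrank ℝ (Amb n) = n + 1) := ⟨by simp⟩
  exact Submodule.finrank_orthogonal_span_singleton (norm_ne_zero_iff.1 (by simp [hz]))

/-- The point of the hyperplane at height one above `x`. -/
def lift {n : ℕ} (x : Horiz n) : Amb n := x + eLast n

theorem inner_eLast_lift {n : ℕ} (x : Horiz n) : ⟪eLast n, lift x⟫_ℝ = 1 := by
  rw [lift, inner_add_right, inner_eLast_coe x, real_inner_self_eq_norm_sq, norm_eLast]
  norm_num

theorem lift_ne_zero {n : ℕ} (x : Horiz n) : lift x ≠ 0 := fun h => by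
  have := inner_eLast_lift x
  simp [h] at this

theorem norm_lift_pos {n : ℕ} (x : Horiz n) : 0 < ‖lift x‖ := norm_pos_iff.2 (lift_ne_zero x)

theorem norm_lift_sq {n : ℕ} (x : Horiz n) : ‖lift x‖ ^ 2 = 1 + ‖x‖ ^ 2 := by
  rw [lift, norm_add_sq_real, real_inner_comm, inner_eLast_coe x, norm_eLast, Submodule.coe_norm]
  ring

/-- The unit vector in the direction of `lift x`. -/
def dir {n : ℕ} (x : Horiz n) : Amb n := ‖lift x‖⁻¹ • lift x

theorem norm_dir {n : ℕ} (x : Horiz n) : ‖dir x‖ = 1 := by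
  rw [dir, norm_smul, norm_inv, norm_norm, inv_mul_cancel₀ (norm_lift_pos x).ne']

/-- The inverse of the central projection of the cap. -/
def chart {n : ℕ} (θ : ℝ) (x : Horiz n) : Amb n := Real.cos θ • eDown n + dir x

theorem nu_chart {n : ℕ} (θ : ℝ) (x : Horiz n) : nu θ (chart θ x) = dir x := by
  simp [nu, chart]

theorem norm_nu_chart {n : ℕ} (θ : ℝ) (x : Horiz n) : ‖nu θ (chart θ x)‖ = 1 := by
  rw [nu_chart, norm_dir]

theorem hasFDerivAt_lift {n : ℕ} (x : Horiz n) :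
    HasFDerivAt (lift (n := n)) (Horiz n).subtypeL x :=
  (Horiz n).subtypeL.hasFDerivAt.add_const _

theorem contDiff_lift (n : ℕ) : ContDiff ℝ ∞ (lift (n := n)) :=
  (Horiz n).subtypeL.contDiff.add contDiff_const

theorem contDiff_norm_lift (n : ℕ) : ContDiff ℝ ∞ fun x : Horiz n => ‖lift x‖ :=
  (contDiff_lift n).norm ℝ lift_ne_zero

theorem contDiff_inv_norm_lift (n : ℕ) : ContDiff ℝ ∞ fun x : Horiz n => ‖lift x‖⁻¹ :=
  (contDiff_norm_lift n).inv fun x => (norm_lift_pos x).ne'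

theorem contDiff_chart (n : ℕ) (θ : ℝ) : ContDiff ℝ ∞ (chart (n := n) θ) :=
  contDiff_const.add ((contDiff_inv_norm_lift n).smul (contDiff_lift n))

theorem hasDerivAt_norm_lift {n : ℕ} (x a : Horiz n) :
    HasDerivAt (fun t : ℝ => ‖lift (x + t • a)‖) ⟪dir x, (a : Amb n)⟫_ℝ 0 := by
  have h1 := ((contDiff_norm_lift n).differentiable (by simp) x).hasFDerivAt.hasDerivAt_line a
  have h2 := h1.pow 2
  have h3 := ((hasFDerivAt_lift x).hasDerivAt_line a).norm_sq
  have h4 := h2.unique h3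
  have hx0 : x + (0 : ℝ) • a = x := by simp
  simp only [hx0, Submodule.subtypeL_apply] at h4
  have hpos := norm_lift_pos x
  have h5 : ⟪dir x, (a : Amb n)⟫_ℝ = fderiv ℝ (fun z : Horiz n => ‖lift z‖) x a := by
    rw [dir, real_inner_smul_left, inv_mul_eq_iff_eq_mul₀ hpos.ne']
    norm_num at h4
    linarith
  rw [h5]
  exact h1

/-- Normalising a vector differentiates to the projection orthogonal to it, divided by its length.
-/
theorem fderiv_chart {n : ℕ} (θ : ℝ) (x a : Horiz n) :
    fderiv ℝ (chart θ) x a = ‖lift x‖⁻¹ •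
      (((tangent θ (chart θ x)).orthogonalProjectionOnto (a : Amb n) : tangent θ (chart θ x)) :
        Amb n) := by
  have h1 := ((contDiff_chart n θ).differentiable (by simp) x).hasFDerivAt.hasDerivAt_line a
  have hpos := norm_lift_pos x
  have hx0 : x + (0 : ℝ) • a = x := by simp
  have h2 := (((hasDerivAt_norm_lift x a).inv (by rw [hx0]; exact hpos.ne')).smul
    ((hasFDerivAt_lift x).hasDerivAt_line a)).const_add (Real.cos θ • eDown n)
  rw [h1.unique h2, coe_orthogonalProjectionOnto_singleton (norm_nu_chart θ x), nu_chart]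
  simp only [hx0, Pi.inv_apply, Submodule.subtypeL_apply]
  rw [smul_sub, sub_eq_add_neg]
  congr 1
  rw [dir, smul_smul, smul_smul, ← neg_smul]
  congr 1
  field_simp

/-- The function on the horizontal hyperplane that represents the function `K` on the cap. -/
def graphFun {n : ℕ} (θ : ℝ) (K : Amb n → ℝ) (x : Horiz n) : ℝ := ‖lift x‖ * K (chart θ x)

theorem contDiff_graphFun {n : ℕ} (θ : ℝ) {K : Amb n → ℝ} (hK : ContDiff ℝ ∞ K) :
    ContDiff ℝ ∞ (graphFun θ K) :=
  (contDiff_norm_lift n).mul (hK.comp (contDiff_chart n θ))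

/-- The 1-homogeneous extension of the function has the support vector as ambient gradient, and
restriction to a horizontal hyperplane projects it. -/
theorem gradient_graphFun {n : ℕ} (θ : ℝ) {K : Amb n → ℝ} (hK : ContDiff ℝ ∞ K) (x : Horiz n) :
    gradient (graphFun θ K) x =
      (Horiz n).orthogonalProjectionOnto (supportField θ K (chart θ x)) := by
  refine ext_inner_right ℝ fun a => ?_
  rw [Submodule.inner_orthogonalProjectionOnto_eq_of_mem_right]
  have h1 := ((hasGradientAt_gradient (contDiff_graphFun θ hK) x).hasFDerivAt).hasDerivAt_line a
  have hch := ((contDiff_chart n θ).differentiable (by simp) x).hasFDerivAt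
  have h2 := ((hasGradientAt_gradient hK (chart θ x)).hasFDerivAt.comp x hch).hasDerivAt_line a
  have h3 := h1.unique ((hasDerivAt_norm_lift x a).mul h2)
  have hx0 : x + (0 : ℝ) • a = x := by simp
  simp only [hx0, InnerProductSpace.toDual_apply_apply, ContinuousLinearMap.comp_apply] at h3
  rw [h3, fderiv_chart, inner_smul_right, mul_inv_cancel_left₀ (norm_lift_pos x).ne',
    coe_orthogonalProjectionOnto_singleton (norm_nu_chart θ x), supportField, tanGrad,
    inner_add_left, inner_sub_left, inner_sub_right, inner_smul_right, real_inner_smul_left,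
    real_inner_smul_left, nu_chart, real_inner_comm (gradient K (chart θ x))]
  ring

/-- The tangential projection of the horizontal hyperplane. -/
def tanProj {n : ℕ} (θ : ℝ) (x : Horiz n) : Horiz n →ₗ[ℝ] tangent θ (chart θ x) :=
  ((tangent θ (chart θ x)).orthogonalProjectionOnto.comp (Horiz n).subtypeL).toLinearMap

/-- The adjoint of `tanProj`. -/
def tanProjAdj {n : ℕ} (θ : ℝ) (x : Horiz n) : tangent θ (chart θ x) →ₗ[ℝ] Horiz n :=
  ((Horiz n).orthogonalProjectionOnto.comp (tangent θ (chart θ x)).subtypeL).toLinearMap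

theorem inner_tanProjAdj {n : ℕ} (θ : ℝ) (x a : Horiz n) (t : tangent θ (chart θ x)) :
    ⟪tanProjAdj θ x t, a⟫_ℝ = ⟪t, tanProj θ x a⟫_ℝ := by
  simp [tanProjAdj, tanProj]

theorem coe_tanProj {n : ℕ} (θ : ℝ) (x a : Horiz n) :
    ((tanProj θ x a : tangent θ (chart θ x)) : Amb n) =
      (a : Amb n) - ⟪dir x, (a : Amb n)⟫_ℝ • dir x := by
  refine (coe_orthogonalProjectionOnto_singleton (norm_nu_chart θ x) (a : Amb n)).trans ?_
  rw [nu_chart]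

theorem tanProj_injective {n : ℕ} (θ : ℝ) (x : Horiz n) : Function.Injective (tanProj θ x) := by
  rw [injective_iff_map_eq_zero]
  intro a ha
  have h1 : (a : Amb n) - ⟪dir x, (a : Amb n)⟫_ℝ • dir x = 0 := by
    rw [← coe_tanProj θ x a, ha, Submodule.coe_zero]
  have h3 : ⟪eLast n, dir x⟫_ℝ = ‖lift x‖⁻¹ := by
    rw [dir, inner_smul_right, inner_eLast_lift, mul_one]
  have h4 : ⟪dir x, (a : Amb n)⟫_ℝ = 0 := by
    have h5 := congrArg (fun y => ⟪eLast n, y⟫_ℝ) h1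
    simp only [inner_sub_right, inner_eLast_coe a, inner_smul_right, h3, inner_zero_right,
      zero_sub, neg_eq_zero] at h5
    exact (mul_eq_zero.1 h5).resolve_right (inv_ne_zero (norm_lift_pos x).ne')
  rw [h4, zero_smul, sub_zero] at h1
  exact Subtype.ext h1

/-- The composite is the rank one perturbation `a ↦ a - ‖lift x‖⁻² ⟪x, a⟫ x` of the identity, so its
determinant is `1 - |x|²/(1 + |x|²)`. -/
theorem det_tanProjAdj_comp_tanProj {n : ℕ} (θ : ℝ) (x : Horiz n) :
    LinearMap.det (tanProjAdj θ x ∘ₗ tanProj θ x) = ‖lift x‖⁻¹ ^ 2 := by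
  have hpos := norm_lift_pos x
  have hPx : (Horiz n).orthogonalProjectionOnto (dir x) = ‖lift x‖⁻¹ • x := by
    rw [dir, map_smul, lift, map_add, Submodule.orthogonalProjectionOnto_mem_subspace_eq_self,
      Submodule.orthogonalProjectionOnto_orthogonalComplement_singleton_eq_zero, add_zero]
  have h1 : tanProjAdj θ x ∘ₗ tanProj θ x = LinearMap.transvection
      (-(‖lift x‖⁻¹ ^ 2 • (innerₗ (Horiz n) x : Horiz n →ₗ[ℝ] ℝ))) x := by
    ext1 a
    have h3 : ⟪dir x, (a : Amb n)⟫_ℝ = ‖lift x‖⁻¹ * ⟪x, a⟫_ℝ := by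
      rw [dir, real_inner_smul_left, lift, inner_add_left, inner_eLast_coe a, add_zero,
        Submodule.coe_inner]
    have h4 : tanProjAdj θ x (tanProj θ x a) =
        (Horiz n).orthogonalProjectionOnto ((tanProj θ x a : tangent θ (chart θ x)) : Amb n) := rfl
    rw [LinearMap.comp_apply, h4, coe_tanProj, map_sub, map_smul, hPx, h3,
      Submodule.orthogonalProjectionOnto_mem_subspace_eq_self, LinearMap.transvection.apply]
    simp only [LinearMap.neg_apply, LinearMap.smul_apply, innerₗ_apply_apply, smul_eq_mul, neg_smul,
      smul_smul, sub_eq_add_neg]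
    congr 3
    ring
  rw [h1, LinearMap.transvection.det]
  simp only [LinearMap.neg_apply, LinearMap.smul_apply, innerₗ_apply_apply, smul_eq_mul,
    real_inner_self_eq_norm_sq]
  have h2 := norm_lift_sq x
  field_simp
  linarith

/-- `tanProj` is an isomorphism between different spaces and has no determinant of its own; writing
the map as `T*T` composed with the conjugate `T⁻¹BT` avoids choosing bases. -/
theorem det_tanProjAdj_comp {n : ℕ} (θ : ℝ) (x : Horiz n)
    (B : tangent θ (chart θ x) →ₗ[ℝ] tangent θ (chart θ x)) :
    LinearMap.det (tanProjAdj θ x ∘ₗ B ∘ₗ tanProj θ x) = ‖lift x‖⁻¹ ^ 2 * LinearMap.det B := by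
  set e := (tanProj θ x).linearEquivOfInjective (tanProj_injective θ x)
    ((finrank_horiz n).trans (finrank_tangent (norm_nu_chart θ x)).symm) with he
  have hea : ∀ a, e a = tanProj θ x a := fun a => LinearMap.linearEquivOfInjective_apply _ _ a
  have h1 : tanProjAdj θ x ∘ₗ B ∘ₗ tanProj θ x = (tanProjAdj θ x ∘ₗ tanProj θ x) ∘ₗ
      ((e.symm : tangent θ (chart θ x) →ₗ[ℝ] Horiz n) ∘ₗ B ∘ₗ
        (e.symm.symm : Horiz n →ₗ[ℝ] tangent θ (chart θ x))) := by
    ext1 a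
    simp [← hea]
  rw [h1, LinearMap.det_comp, LinearMap.det_conj, det_tanProjAdj_comp_tanProj]

/-- One projection comes from the chart and the other from the horizontal part of the support field,
whose tangential derivative is `∇²h + hI`. -/
theorem hessian_graphFun {n : ℕ} (θ : ℝ) {K : Amb n → ℝ} (hK : ContDiff ℝ ∞ K) (x : Horiz n) :
    (fderiv ℝ (gradient (graphFun θ K)) x : Horiz n →ₗ[ℝ] Horiz n) = ‖lift x‖⁻¹ •
      (tanProjAdj θ x ∘ₗ (tanHess θ K (chart θ x) + K (chart θ x) • LinearMap.id) ∘ₗ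
        tanProj θ x) := by
  have hch := ((contDiff_chart n θ).differentiable (by simp) x).hasFDerivAt
  have h1 : HasFDerivAt (gradient (graphFun θ K)) ((Horiz n).orthogonalProjectionOnto.comp
      ((fderiv ℝ (supportField θ K) (chart θ x)).comp (fderiv ℝ (chart θ) x))) x := by
    have h2 := (Horiz n).orthogonalProjectionOnto.hasFDerivAt.comp x
      ((differentiable_supportField (θ := θ) hK (chart θ x)).hasFDerivAt.comp x hch)
    refine h2.congr_of_eventuallyEq (Filter.Eventually.of_forall fun z => ?_)
    exact gradient_graphFun θ hK z
  rw [h1.fderiv]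
  ext1 a
  have h3 := fderiv_supportField hK (norm_nu_chart θ x) (tanProj θ x a)
  have h4 : fderiv ℝ (chart θ) x a = ‖lift x‖⁻¹ • ((tanProj θ x a : tangent θ (chart θ x)) : Amb n) :=
    fderiv_chart θ x a
  simp only [ContinuousLinearMap.coe_coe, ContinuousLinearMap.comp_apply, h4, map_smul, h3,
    LinearMap.smul_apply, LinearMap.comp_apply]
  rfl

/-! ### The cap as the image of the ball of radius `tan θ`, and the transformed equation. -/

theorem inner_eLast_eDown (n : ℕ) : ⟪eLast n, eDown n⟫_ℝ = -1 := by
  rw [eDown, inner_neg_right, real_inner_self_eq_norm_sq, norm_eLast]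
  norm_num

theorem inner_eLast_dir {n : ℕ} (x : Horiz n) : ⟪eLast n, dir x⟫_ℝ = ‖lift x‖⁻¹ := by
  rw [dir, inner_smul_right, inner_eLast_lift, mul_one]

theorem chart_last {n : ℕ} (θ : ℝ) (x : Horiz n) :
    chart θ x (Fin.last n) = ‖lift x‖⁻¹ - Real.cos θ := by
  rw [← inner_eLast, chart, inner_add_right, inner_smul_right, inner_eLast_eDown, inner_eLast_dir]
  ring

theorem one_add_tan_sq_mul {θ : ℝ} (hc : 0 < Real.cos θ) :
    (1 + Real.tan θ ^ 2) * Real.cos θ ^ 2 = 1 := by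
  rw [Real.tan_eq_sin_div_cos]
  field_simp
  linarith [Real.sin_sq_add_cos_sq θ]

theorem norm_lift_mul_cos_le {n : ℕ} {θ : ℝ} (hc : 0 < Real.cos θ) {x : Horiz n}
    (hx : ‖x‖ ≤ Real.tan θ) : ‖lift x‖ * Real.cos θ ≤ 1 := by
  have h1 : (‖lift x‖ * Real.cos θ) ^ 2 ≤ 1 := by
    rw [mul_pow, norm_lift_sq]
    refine le_trans ?_ (one_add_tan_sq_mul hc).le
    have := pow_le_pow_left₀ (norm_nonneg x) hx 2
    gcongr
  exact (sq_le_one_iff₀ (mul_nonneg (norm_nonneg _) hc.le)).1 h1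

theorem norm_lift_inv_eq_cos {n : ℕ} {θ : ℝ} (hc : 0 < Real.cos θ) {x : Horiz n}
    (hx : ‖x‖ = Real.tan θ) : ‖lift x‖⁻¹ = Real.cos θ := by
  have h1 : (‖lift x‖ * Real.cos θ) ^ 2 = 1 := by
    rw [mul_pow, norm_lift_sq, hx, one_add_tan_sq_mul hc]
  have h2 := (pow_eq_one_iff_of_nonneg (mul_nonneg (norm_nonneg _) hc.le) two_ne_zero).1 h1
  exact inv_eq_of_mul_eq_one_right h2

theorem chart_mem_cap {n : ℕ} {θ : ℝ} (hc : 0 < Real.cos θ) {x : Horiz n}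
    (hx : ‖x‖ ≤ Real.tan θ) : chart θ x ∈ cap n θ := by
  refine ⟨?_, norm_nu_chart θ x⟩
  rw [chart_last, sub_nonneg, le_inv_comm₀ hc (norm_lift_pos x), ← one_div, le_div_iff₀ hc]
  exact norm_lift_mul_cos_le hc hx

theorem exists_chart_eq {n : ℕ} {θ : ℝ} (hc : 0 < Real.cos θ) (ht : 0 ≤ Real.tan θ) {ξ : Amb n}
    (hξ : ξ ∈ cap n θ) : ∃ x : Horiz n, ‖x‖ ≤ Real.tan θ ∧ chart θ x = ξ := by
  -- The height of `ξ` above the centre of the sphere; dividing the normal by it reaches the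
  -- hyperplane at height one.
  set τ : ℝ := ξ (Fin.last n) + Real.cos θ with hτ
  have hτc : Real.cos θ ≤ τ := by linarith [hξ.1]
  have hτ0 : 0 < τ := hc.trans_le hτc
  have hinner : ⟪eLast n, nu θ ξ⟫_ℝ = τ := by
    rw [nu, inner_sub_right, inner_smul_right, inner_eLast_eDown, inner_eLast]
    ring
  have hmem : τ⁻¹ • nu θ ξ - eLast n ∈ Horiz n := by
    rw [Submodule.mem_orthogonal_singleton_iff_inner_right, inner_sub_right, inner_smul_right,
      hinner, real_inner_self_eq_norm_sq, norm_eLast, inv_mul_cancel₀ hτ0.ne']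
    norm_num
  have hlift : lift (⟨_, hmem⟩ : Horiz n) = τ⁻¹ • nu θ ξ := by simp [lift]
  have hnorm : ‖lift (⟨_, hmem⟩ : Horiz n)‖ = τ⁻¹ := by
    rw [hlift, norm_smul, norm_nu hξ, mul_one, Real.norm_of_nonneg (inv_nonneg.2 hτ0.le)]
  refine ⟨⟨_, hmem⟩, ?_, ?_⟩
  · have h1 := norm_lift_sq (⟨_, hmem⟩ : Horiz n)
    rw [hnorm] at h1
    have h2 : τ⁻¹ ^ 2 ≤ 1 + Real.tan θ ^ 2 := by
      rw [eq_inv_of_mul_eq_one_left (one_add_tan_sq_mul hc), inv_pow]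
      gcongr
    exact (pow_le_pow_iff_left₀ (norm_nonneg _) ht two_ne_zero).1 (by linarith)
  · rw [chart, dir, hnorm, hlift, inv_smul_smul₀ (inv_ne_zero hτ0.ne'), nu]
    abel

theorem inner_lift_supportField {n : ℕ} (θ : ℝ) (K : Amb n → ℝ) (x : Horiz n) :
    ⟪lift x, supportField θ K (chart θ x)⟫_ℝ = graphFun θ K x := by
  have h1 := inner_nu_supportField K (norm_nu_chart θ x)
  rw [nu_chart, dir, real_inner_smul_left, inv_mul_eq_iff_eq_mul₀ (norm_lift_pos x).ne'] at h1
  exact h1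

theorem graphFun_sub_inner_gradient {n : ℕ} (θ : ℝ) {K : Amb n → ℝ} (hK : ContDiff ℝ ∞ K)
    (x : Horiz n) : graphFun θ K x - ⟪x, gradient (graphFun θ K) x⟫_ℝ =
      ⟪eLast n, supportField θ K (chart θ x)⟫_ℝ := by
  rw [gradient_graphFun θ hK, Submodule.inner_orthogonalProjectionOnto_eq_of_mem_left,
    ← inner_lift_supportField, lift, inner_add_left]
  ring

theorem normSq_graphFun {n : ℕ} (θ : ℝ) {K : Amb n → ℝ} (hK : ContDiff ℝ ∞ K) (x : Horiz n) :
    ‖gradient (graphFun θ K) x‖ ^ 2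
      + (graphFun θ K x - ⟪x, gradient (graphFun θ K) x⟫_ℝ) ^ 2 =
      K (chart θ x) ^ 2 + ‖tanGrad θ K (chart θ x)‖ ^ 2 := by
  rw [graphFun_sub_inner_gradient θ hK, gradient_graphFun θ hK,
    ← norm_supportField_sq K (norm_nu_chart θ x), Submodule.coe_norm,
    coe_orthogonalProjectionOnto_singleton (norm_eLast n), norm_sub_sq_real, inner_smul_right,
    norm_smul, norm_eLast, real_inner_comm, Real.norm_eq_abs, mul_one, sq_abs]
  ring

/-- The right-hand side of the Monge–Ampère equation in the central projection. -/
def graphData {n : ℕ} (θ p : ℝ) (F : Amb n → ℝ) (x : Horiz n) : ℝ :=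
  ‖lift x‖⁻¹ ^ (n + 2) * ‖lift x‖⁻¹ ^ (p - 1) * F (chart θ x)

theorem contDiff_graphData {n : ℕ} (θ p : ℝ) {F : Amb n → ℝ} (hF : ContDiff ℝ ∞ F) :
    ContDiff ℝ ∞ (graphData θ p F) :=
  (((contDiff_inv_norm_lift n).pow (n + 2)).mul ((contDiff_inv_norm_lift n).rpow_const_of_ne
    fun x => (inv_pos.2 (norm_lift_pos x)).ne')).mul (hF.comp (contDiff_chart n θ))

/-- The capillary condition says that the support vector is horizontal: tangency of `∇h` expresses
`⟪∇h, ξ⟫` through its vertical component, which leaves `⟪E, ∇h⟫ = -cos θ h`. -/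
theorem inner_eLast_supportField_eq_zero {n : ℕ} {θ : ℝ} (hs : 0 < Real.sin θ) {K : Amb n → ℝ}
    {ξ : Amb n} (hξ : ξ ∈ capBoundary n θ)
    (h : ⟪tanGrad θ K ξ, conormal θ ξ⟫_ℝ = Real.cot θ * K ξ) :
    ⟪eLast n, supportField θ K ξ⟫_ℝ = 0 := by
  have h1 : ⟪nu θ ξ, tanGrad θ K ξ⟫_ℝ = 0 := mem_tangent.1 (tanGrad_mem hξ.1 K)
  have h2 : ⟪eLast n, nu θ ξ⟫_ℝ = Real.cos θ := by
    rw [nu, inner_sub_right, inner_smul_right, inner_eLast_eDown, inner_eLast, hξ.2]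
    ring
  have h3 : ⟪tanGrad θ K ξ, ξ⟫_ℝ = -(Real.cos θ * ⟪eLast n, tanGrad θ K ξ⟫_ℝ) := by
    rw [nu, inner_sub_left, real_inner_smul_left, eDown, inner_neg_left] at h1
    rw [real_inner_comm]
    linarith
  rw [conormal, inner_add_right, inner_smul_right, inner_smul_right, inner_smul_right, h3, eDown,
    inner_neg_right, real_inner_comm, Real.cot_eq_cos_div_sin] at h
  rw [supportField, inner_add_right, inner_smul_right, h2]
  field_simp at h
  have h4 : ⟪eLast n, tanGrad θ K ξ⟫_ℝ * (Real.sin θ ^ 2 + Real.cos θ ^ 2) =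
      -(Real.cos θ * K ξ) := by linarith
  rw [Real.sin_sq_add_cos_sq, mul_one] at h4
  rw [h4]
  ring

/-- A solution of the capillary `L_p` dual Minkowski equation gives a solution of a Monge–Ampère
equation on a ball, with a Robin boundary condition. -/
theorem IsSolution.graphSolution {n : ℕ} {θ : ℝ} (hc : 0 < Real.cos θ) (hs : 0 < Real.sin θ)
    {p q : ℝ} {f h : cap n θ → ℝ} (hh : IsSolution p q f h) {F : Amb n → ℝ}
    (hF : ∀ ξ : cap n θ, F ξ = f ξ) :
    GraphSolution (Real.tan θ) p (((n : ℝ) + 1 - q) / 2) (graphData θ p F)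
      (graphFun θ (capExt h)) := by
  obtain ⟨hK, hKh⟩ := capExt_spec hh.smooth
  have hpos : ∀ x : Horiz n, ‖x‖ ≤ Real.tan θ → 0 < capExt h (chart θ x) := fun x hx => by
    rw [hKh ⟨_, chart_mem_cap hc hx⟩]
    exact hh.pos _
  have hhess : ∀ x : Horiz n, ∀ hx : ‖x‖ ≤ Real.tan θ,
      (fderiv ℝ (gradient (graphFun θ (capExt h))) x : Horiz n →ₗ[ℝ] Horiz n) = ‖lift x‖⁻¹ •
        (tanProjAdj θ x ∘ₗ capB h ⟨chart θ x, chart_mem_cap hc hx⟩ ∘ₗ tanProj θ x) := by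
    intro x hx
    rw [hessian_graphFun θ hK, hKh ⟨_, chart_mem_cap hc hx⟩]
    rfl
  refine ⟨contDiff_graphFun θ hK, fun x hx => mul_pos (norm_lift_pos x) (hpos x hx),
    fun x hx a ha => ?_, fun x hx => ?_, fun x hx => ?_⟩
  · have h1 := hh.strictConvex ⟨chart θ x, chart_mem_cap hc hx⟩ (tanProj θ x a)
      (fun h0 => ha (tanProj_injective θ x (h0.trans (map_zero _).symm)))
    have h2 := congrArg (fun L : Horiz n →ₗ[ℝ] Horiz n => ⟪L a, a⟫_ℝ) (hhess x hx)
    simp only [ContinuousLinearMap.coe_coe, LinearMap.smul_apply, LinearMap.comp_apply,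
      real_inner_smul_left, inner_tanProjAdj] at h2
    rw [h2]
    exact mul_pos (inv_pos.2 (norm_lift_pos x)) h1
  · have h1 := hh.equation ⟨chart θ x, chart_mem_cap hc hx⟩
    rw [← hKh, ← hF] at h1
    rw [hhess x hx, LinearMap.det_smul, finrank_horiz, det_tanProjAdj_comp, h1, normSq_graphFun θ hK,
      graphData, graphFun, Real.mul_rpow (norm_lift_pos x).le (hpos x hx).le,
      Real.inv_rpow (norm_lift_pos x).le]
    have h2 := Real.rpow_pos_of_pos (norm_lift_pos x) (p - 1)
    change _ * (_ * (_ * _ * (_ + ‖tanGrad θ (capExt h) (chart θ x)‖ ^ 2) ^ _)) = _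
    -- The exponent `n + 2` in `graphData` is `n` from the scalar factor in the Hessian and `2` from
    -- the determinant of the projections.
    rw [pow_add]
    generalize ‖lift x‖⁻¹ ^ n = A
    generalize ‖lift x‖⁻¹ ^ 2 = B
    field_simp
  · have hlast := chart_last θ x
    rw [norm_lift_inv_eq_cos hc hx, sub_self] at hlast
    have hb : chart θ x ∈ capBoundary n θ := ⟨chart_mem_cap hc hx.le, hlast⟩
    have h1 := hh.boundary ⟨chart θ x, hb.1⟩ hb
    rw [← hKh] at h1
    have h2 := inner_eLast_supportField_eq_zero hs hb h1
    rw [← graphFun_sub_inner_gradient θ hK] at h2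
    linarith

theorem isCompact_cap (n : ℕ) (θ : ℝ) : IsCompact (cap n θ) := by
  refine Metric.isCompact_of_isClosed_isBounded ?_ ?_
  · have h1 : Continuous fun z : Amb n => z (Fin.last n) := by fun_prop
    have h2 : Continuous fun z : Amb n => ‖z - Real.cos θ • eDown n‖ := by fun_prop
    exact (isClosed_le continuous_const h1).inter (isClosed_eq h2 continuous_const)
  · refine Metric.isBounded_closedBall.subset (fun z hz => ?_) (t := Metric.closedBall
      (Real.cos θ • eDown n) 1)
    rw [Metric.mem_closedBall, dist_eq_norm]
    exact hz.2.le

theorem bddAbove_range_of_capSmooth {n : ℕ} {θ : ℝ} {h : cap n θ → ℝ} (hs : CapSmooth h) :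
    BddAbove (Set.range h) := by
  obtain ⟨H, hH, hHh⟩ := hs
  obtain ⟨M, hM⟩ := ((isCompact_cap n θ).image hH.continuous).bddAbove
  refine ⟨M, ?_⟩
  rintro _ ⟨ξ, rfl⟩
  exact hM ⟨ξ, ξ.2, hHh ξ⟩

end Capillary

end

/-! ### The estimate on the cap. -/

theorem lemma5p1 (n : ℕ) (hn : 1 ≤ n) (θ : ℝ) (hθ : θ ∈ Set.Ioo 0 (Real.pi / 2))
    (p q : ℝ) (hp : 1 < p) (hq : q ≤ (n : ℝ) + 1)
    (f : Capillary.cap n θ → ℝ) (hf : Capillary.CapSmooth f) (hfpos : ∀ ξ, 0 < f ξ)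
    (γ : ℝ) (hγ : 0 < γ) (hγ' : γ < min (2 * (p - 1) / (n : ℝ)) 2) :
    ∃ C : ℝ, 0 < C ∧ ∀ h : Capillary.cap n θ → ℝ, Capillary.IsSolution p q f h →
      ∀ ξ : Capillary.cap n θ,
        ‖Capillary.capGrad h ξ‖ ^ 2 / h ξ ^ γ ≤ C * (⨆ ζ : Capillary.cap n θ, h ζ) ^ (2 - γ) := by
  have hc : 0 < Real.cos θ := Real.cos_pos_of_mem_Ioo ⟨by linarith [hθ.1, hθ.2], hθ.2⟩
  have hs : 0 < Real.sin θ := Real.sin_pos_of_pos_of_lt_pi hθ.1 (by linarith [hθ.1, hθ.2])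
  have ht : 0 < Real.tan θ := Real.tan_pos_of_pos_of_lt_pi_div_two hθ.1 hθ.2
  obtain ⟨F, hF, hFf⟩ := hf
  have hn0 : (0 : ℝ) < n := by exact_mod_cast hn
  have hγ2 : γ < 2 := hγ'.trans_le (min_le_right _ _)
  have hγp : (Module.finrank ℝ (Capillary.Horiz n) : ℝ) * γ < 2 * (p - 1) := by
    have h1 := hγ'.trans_le (min_le_left _ _)
    rw [lt_div_iff₀ hn0] at h1
    rw [Capillary.finrank_horiz]
    linarith
  have hgpos : ∀ x : Capillary.Horiz n, ‖x‖ ≤ Real.tan θ → 0 < Capillary.graphData θ p F x := by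
    intro x hx
    have h1 := inv_pos.2 (Capillary.norm_lift_pos x)
    have h2 : 0 < F (Capillary.chart θ x) := by
      rw [hFf ⟨_, Capillary.chart_mem_cap hc hx⟩]
      exact hfpos _
    exact mul_pos (mul_pos (pow_pos h1 _) (Real.rpow_pos_of_pos h1 _)) h2
  obtain ⟨C, hC, hbound⟩ := Capillary.GraphSolution.exists_gradient_bound ht hp
    (s := ((n : ℝ) + 1 - q) / 2) (by linarith) (Capillary.contDiff_graphData θ p hF) hgpos hγ hγ2
    hγp
  set c : ℝ := (Real.cos θ)⁻¹ with hcdef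
  have hc0 : 0 < c := inv_pos.2 hc
  refine ⟨C * (c ^ (2 - γ) * c ^ γ), by positivity, fun h hh ξ => ?_⟩
  obtain ⟨hK, hKh⟩ := Capillary.capExt_spec hh.smooth
  have hbdd := Capillary.bddAbove_range_of_capSmooth hh.smooth
  set M := ⨆ ζ : Capillary.cap n θ, h ζ with hM
  have hMpos : 0 < M := (hh.pos ξ).trans_le (le_ciSup hbdd ξ)
  -- On the ball the conformal factor between `w` and `h` is at most `1 / cos θ`, which accounts for
  -- the powers of `c` in the constant.
  have hlift : ∀ x : Capillary.Horiz n, ‖x‖ ≤ Real.tan θ → ‖Capillary.lift x‖ ≤ c := fun x hx => by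
    rw [hcdef, ← one_div, le_div_iff₀ hc]
    exact Capillary.norm_lift_mul_cos_le hc hx
  have hwM : ∀ x : Capillary.Horiz n, ‖x‖ ≤ Real.tan θ →
      Capillary.graphFun θ (Capillary.capExt h) x ≤ c * M := by
    intro x hx
    rw [Capillary.graphFun, hKh ⟨_, Capillary.chart_mem_cap hc hx⟩]
    exact mul_le_mul (hlift x hx) (le_ciSup hbdd _) (hh.pos _).le hc0.le
  obtain ⟨x, hx, hxξ⟩ := Capillary.exists_chart_eq hc ht.le ξ.2
  have h1 := hbound _ (hh.graphSolution hc hs hFf) _ hwM x hx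
  have hpos := hh.pos ξ
  rw [Capillary.normSq_graphFun θ hK, Capillary.graphFun, hxξ, hKh ξ] at h1
  have h2 : (‖Capillary.lift x‖ * h ξ) ^ γ ≤ c ^ γ * h ξ ^ γ := by
    rw [← Real.mul_rpow hc0.le hpos.le]
    exact Real.rpow_le_rpow (by positivity) (mul_le_mul_of_nonneg_right (hlift x hx) hpos.le) hγ.le
  rw [Real.mul_rpow hc0.le hMpos.le] at h1
  rw [div_le_iff₀ (Real.rpow_pos_of_pos hpos γ)]
  change ‖Capillary.tanGrad θ (Capillary.capExt h) ξ‖ ^ 2 ≤ _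
  have h3 : C * (c ^ (2 - γ) * M ^ (2 - γ)) * (‖Capillary.lift x‖ * h ξ) ^ γ ≤
      C * (c ^ (2 - γ) * M ^ (2 - γ)) * (c ^ γ * h ξ ^ γ) :=
    mul_le_mul_of_nonneg_left h2 (by positivity)
  -- The estimate on the ball controls `h² + |∇h|²`; the first summand is dropped.
  linarith [sq_nonneg (h ξ)]
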